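/- Let $d\in\mathbb N$ and let $\{X_{nj} : n\in\mathbb N,\ j\in\mathbb Z^d\}$ be real random variables with mean zero on a probability space $(\Omega,\mathcal F,P)$ such that, for each $n$, the variables $X_{nj}$, $j\in\mathbb Z^d$, are independent. Suppose that for each $n$ there is $H_n>0$ such that, for every $j$, $E e^{zX_{nj}}$ is finite for $|z|<H_n$, $z\in\mathbb C$, and the cumulant generating function $L_{nj}(z)=\log E e^{zX_{nj}}$ (with the branch of the logarithm for which $L_{nj}(0)=0$) is analytic in the disc $|z|<H_n$. Let $\gamma_{3nj}=L_{nj}'''(0)$ be the third cumulant of $X_{nj}$. Assume that $$B_n=\sum_{j\in\mathbb Z^d}E X_{nj}^2<\infty$$ and that the sum $S_n=\sum_{j\in\mathbb Z^d}X_{nj}$ is well defined as the limit (in probability) of $\sum_{j\in[-m,m]^d\cap\mathbb Z^d}X_{nj}$ as $m\to\infty$. Put $F_n(x)=P(S_n<x\sqrt{B_n})$, and let $\Phi$ be the standard normal distribution function. Suppose that there are constants $c_{nj}\ge 0$ with $|L_{nj}(z)|\le c_{nj}$ for all $z\in\mathbb C$ with $|z|<H_n$, that $C_n:=\sum_{j\in\mathbb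 Z^d}c_{nj}<\infty$ for every $n$, that $B_nH_n^2\to\infty$, and that $C_n=O(B_nH_n^2)$ as $n\to\infty$. Then $\sum_{j\in\mathbb Z^d}\gamma_{3nj}$ converges absolutely for every $n$, and for $x\ge 0$ with $x=O\big((H_n\sqrt{B_n})^{1/3}\big)$, $$1-F_n(x)=(1-\Phi(x))\exp\Big\{\frac{x^3}{6B_n^{3/2}}\sum_{j\in\mathbb Z^d}\gamma_{3nj}\Big\}+O\Big(\frac{e^{-x^2/2}}{H_n\sqrt{B_n}}\Big);$$ that is, for every $K$ there is $M$ such that, for all sufficiently large $n$ and all $x$ with $0\le x\le K(H_n\sqrt{B_n})^{1/3}$, the two sides without the error term differ by at most $M e^{-x^2/2}/(H_n\sqrt{B_n})$. -/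

import Mathlib

open MeasureTheory ProbabilityTheory Filter Topology

/-- The cube `Γ^d_m = [-m, m]^d ∩ ℤ^d`. -/
noncomputable def latticeCube (d m : ℕ) : Finset (Fin d → ℤ) :=
  Finset.Icc (fun _ => -(m : ℤ)) (fun _ => (m : ℤ))

/-- `S = ∑_{j ∈ ℤ^d} X j`, as the limit of the sums over the cubes `Γ^d_m`. The limit is taken in
probability, the weakest of the usual modes: an almost sure limit or an `L²` limit qualifies too. -/
def IsLatticeSum {Ω : Type*} [MeasurableSpace Ω] {d : ℕ} (X : (Fin d → ℤ) → Ω → ℝ)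
    (P : Measure Ω) (S : Ω → ℝ) : Prop :=
  TendstoInMeasure P (fun (m : ℕ) ω => ∑ j ∈ latticeCube d m, X j ω) atTop S

/-- `E e^{zX}` is finite in the disc `|z| < H` and `L(z) = log E e^{zX}` is analytic there, with the
branch of the logarithm for which `L(0) = 0`. -/
structure IsAnalyticCGF {Ω : Type*} [MeasurableSpace Ω] (X : Ω → ℝ) (P : Measure Ω)
    (H : ℝ) (L : ℂ → ℂ) : Prop where
  integrable_exp : ∀ t : ℝ, |t| < H → Integrable (fun ω => Real.exp (t * X ω)) P
  analytic : AnalyticOnNhd ℂ L (Metric.ball 0 H)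
  map_zero : L 0 = 0
  exp_eq : ∀ z ∈ Metric.ball (0 : ℂ) H, Complex.exp (L z) = complexMGF X P z

/-- The principal logarithm of `E e^{zX}` satisfies the definition whenever it is analytic in the
disc. -/
theorem IsAnalyticCGF.of_log {Ω : Type*} [MeasurableSpace Ω] {X : Ω → ℝ} {P : Measure Ω}
    [IsProbabilityMeasure P] {H : ℝ} (hH : 0 < H)
    (hint : ∀ t : ℝ, |t| < H → Integrable (fun ω => Real.exp (t * X ω)) P)
    (han : AnalyticOnNhd ℂ (fun z => Complex.log (complexMGF X P z)) (Metric.ball 0 H)) :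
    IsAnalyticCGF X P H (fun z => Complex.log (complexMGF X P z)) := by
  have h0 : complexMGF X P 0 = 1 := by simp [complexMGF]
  refine ⟨hint, han, by simp [h0], fun z hz => ?_⟩
  apply Complex.exp_log
  intro hz0
  have hMan : AnalyticOnNhd ℂ (complexMGF X P) (Metric.ball 0 H) := by
    refine analyticOnNhd_complexMGF.mono fun w hw => ?_
    have hw' : |w.re| < H := lt_of_le_of_lt (Complex.abs_re_le_norm w) (by simpa using hw)
    refine mem_interior.2 ⟨Set.Ioo (-H) H, fun t ht => hint t (abs_lt.2 ht), isOpen_Ioo,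
      abs_lt.1 hw'⟩
  have hc1 : ContinuousAt (complexMGF X P) z := (hMan z hz).continuousAt
  have hc2 : ContinuousAt (fun w => Complex.exp (Complex.log (complexMGF X P w))) z :=
    (han z hz).continuousAt.cexp
  have e1 : ∀ᶠ w in 𝓝 z, ‖complexMGF X P w‖ < 1 / 2 := by
    have := hc1.norm
    exact this.eventually_lt continuousAt_const (by simp [hz0])
  have e2 : ∀ᶠ w in 𝓝 z, 1 / 2 < ‖Complex.exp (Complex.log (complexMGF X P w))‖ :=
    continuousAt_const.eventually_lt hc2.norm (by simp [hz0]; norm_num)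
  have e3 : complexMGF X P =ᶠ[𝓝 z] 0 := by
    filter_upwards [e1, e2] with w h1 h2
    by_contra hne
    rw [Complex.exp_log hne] at h2
    linarith
  have := hMan.eqOn_zero_of_preconnected_of_eventuallyEq_zero
    (convex_ball (0 : ℂ) H).isPreconnected hz e3 (Metric.mem_ball_self hH)
  simp [h0] at this

/-- The cumulant of order `k` of `X`: the `k`-th derivative at `0` of `t ↦ log E e^{tX}`. -/
noncomputable def cumulant {Ω : Type*} [MeasurableSpace Ω] (k : ℕ) (X : Ω → ℝ)
    (P : Measure Ω) : ℝ :=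
  iteratedDeriv k (cgf X P) 0

/-- `B = ∑_{j ∈ ℤ^d} Var (X j)`. -/
noncomputable def latticeVariance {Ω : Type*} [MeasurableSpace Ω] {d : ℕ}
    (X : (Fin d → ℤ) → Ω → ℝ) (P : Measure Ω) : ℝ :=
  ∑' j, variance (X j) P

/-- The normalized distribution function `F(x) = P(S < x √B)`, with strict inequality. -/
noncomputable def normalizedDF {Ω : Type*} [MeasurableSpace Ω] (S : Ω → ℝ) (B : ℝ)
    (P : Measure Ω) (x : ℝ) : ℝ :=
  P.real {ω | S ω < x * √B}

/-- The distribution function `Φ` of the standard normal law. -/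
noncomputable def stdNormalDF (x : ℝ) : ℝ :=
  cdf (gaussianReal 0 1) x

/-!
Let `Z = S / √B`, let `K` be its cumulant generating function, and put `D = H √B`. Up to the branch
of the logarithm, `K` is the restriction to the real line of `z ↦ ∑' j, L j (z / √B)`, which is
analytic and `O(D²)` in the disc of radius `D`: this holds for the partial sums, and convergence in
probability carries the characteristic functions to the limit. By Cauchy's estimates
`K''' = O(1 / D)` and `K'''' = O(1 / D²)` in a smaller disc.

Tilt the law of `Z` by `e^{xZ}`, with `x` itself as parameter instead of the solution of the saddle
point equation `K'(h) = x`. Then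
`P(Z ≥ x) = e^{K(x) - x²} ∫_{y ≥ x} e^{-x (y - x)} dQ(y)`,
where the tilted law `Q` has mean `x + O(x² / D)` and variance `1 + O(x / D)`. Esseen's smoothing
inequality, with the Fejér kernel, puts `Q` within `O(1 / D)` in Kolmogorov distance of the Gaussian
law with the same mean and variance, and the integrand is unimodal with maximum `1`, so the integral
may be computed for that Gaussian law. The Laplace transform of a half-line Gaussian is so small for
large `x` that for `x³ = O(D)` replacing the mean and variance by `x` and `1` costs `O(1 / D)`; at
those values the integral is `e^{x²/2} (1 - Φ(x))`. The remainder `K(x) - x²/2 - κ₃ x³/6`, which is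
`O(x⁴ / D²)`, is harmless for the same reason.
-/

/-! ### Esseen's smoothing inequality -/

/-- The Fejér kernel `v ↦ ∫₀¹ (1 - t) cos (t v) dt`, a multiple of a probability density whose
Fourier transform vanishes outside `[-1, 1]`. -/
noncomputable def fejerKernel (v : ℝ) : ℝ :=
  ∫ t in (0 : ℝ)..1, (1 - t) * Real.cos (t * v)

theorem fejerKernel_zero : fejerKernel 0 = 1 / 2 := by
  simp only [fejerKernel, mul_zero, Real.cos_zero, mul_one]
  rw [intervalIntegral.integral_sub (by simp) (by simp), integral_id,
    intervalIntegral.integral_const]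
  norm_num

theorem fejerKernel_eq {v : ℝ} (hv : v ≠ 0) : fejerKernel v = (1 - Real.cos v) / v ^ 2 := by
  have hderiv : ∀ t ∈ Set.uIcc (0 : ℝ) 1, HasDerivAt
      (fun t => (1 - t) * (Real.sin (t * v) / v) - Real.cos (t * v) / v ^ 2)
      ((1 - t) * Real.cos (t * v)) t := by
    intro t _
    have hlin : HasDerivAt (fun t : ℝ => t * v) v t := by simpa using (hasDerivAt_id t).mul_const v
    convert! (((hasDerivAt_id t).const_sub 1).mul (hlin.sin.div_const v)).sub
      (hlin.cos.div_const (v ^ 2)) using 1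
    simp only [id_eq]
    field_simp
    ring
  rw [fejerKernel, intervalIntegral.integral_eq_sub_of_hasDerivAt hderiv
    (by apply Continuous.intervalIntegrable; fun_prop)]
  simp only [sub_self, zero_mul, one_mul, Real.sin_zero, Real.cos_zero, zero_div, mul_zero]
  ring

theorem fejerKernel_nonneg (v : ℝ) : 0 ≤ fejerKernel v := by
  rcases eq_or_ne v 0 with rfl | hv
  · norm_num [fejerKernel_zero]
  · rw [fejerKernel_eq hv]
    exact div_nonneg (sub_nonneg.2 (Real.cos_le_one v)) (sq_nonneg v)

theorem continuous_fejerKernel : Continuous fejerKernel := by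
  unfold fejerKernel
  apply intervalIntegral.continuous_parametric_intervalIntegral_of_continuous'
  fun_prop

theorem fejerKernel_le (v : ℝ) : fejerKernel v ≤ 5 * (1 + v ^ 2)⁻¹ := by
  rw [← div_eq_mul_inv]
  rcases eq_or_ne v 0 with rfl | hv
  · norm_num [fejerKernel_zero]
  · rw [fejerKernel_eq hv, div_le_div_iff₀ (by positivity) (by positivity)]
    nlinarith [Real.one_sub_sq_div_two_le_cos (x := v), Real.neg_one_le_cos v, sq_nonneg v]

theorem integrable_fejerKernel : Integrable fejerKernel := by
  refine (integrable_inv_one_add_sq.const_mul 5).mono'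
    continuous_fejerKernel.aestronglyMeasurable (ae_of_all _ fun v => ?_)
  rw [Real.norm_of_nonneg (fejerKernel_nonneg v)]
  exact fejerKernel_le v

theorem integral_fejerKernel_pos : 0 < ∫ v, fejerKernel v :=
  integral_pos_of_integrable_nonneg_nonzero (x := 0) continuous_fejerKernel
    integrable_fejerKernel fejerKernel_nonneg (by norm_num [fejerKernel_zero])

theorem intervalIntegral_cos_mul {t : ℝ} (ht : t ≠ 0) (b : ℝ) :
    ∫ v in (0 : ℝ)..b, Real.cos (t * v) = Real.sin (t * b) / t := by
  rw [intervalIntegral.integral_comp_mul_left _ ht, integral_cos, mul_zero, Real.sin_zero,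
    sub_zero, smul_eq_mul, inv_mul_eq_div]

theorem mul_sinc_mul {t : ℝ} (ht : t ≠ 0) (b : ℝ) :
    b * Real.sinc (t * b) = Real.sin (t * b) / t := by
  rcases eq_or_ne b 0 with rfl | hb
  · simp
  · rw [Real.sinc_of_ne_zero (mul_ne_zero ht hb)]
    field_simp

theorem intervalIntegral_fejerKernel (b : ℝ) :
    ∫ v in (0 : ℝ)..b, fejerKernel v =
      ∫ t in (0 : ℝ)..1, (1 - t) * (b * Real.sinc (t * b)) := by
  have hint : IntegrableOn (Function.uncurry fun v t : ℝ => (1 - t) * Real.cos (t * v))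
      (Set.uIoc 0 b ×ˢ Set.uIoc 0 1) := by
    refine IntegrableOn.mono_set (t := Set.uIcc 0 b ×ˢ Set.uIcc 0 1) ?_
      (Set.prod_mono Set.uIoc_subset_uIcc Set.uIoc_subset_uIcc)
    refine ContinuousOn.integrableOn_compact (isCompact_uIcc.prod isCompact_uIcc) ?_
    exact Continuous.continuousOn (by unfold Function.uncurry; fun_prop)
  unfold fejerKernel
  rw [MeasureTheory.intervalIntegral_intervalIntegral_swap hint]
  refine intervalIntegral.integral_congr fun t _ => ?_
  rcases eq_or_ne t 0 with rfl | ht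
  · simp
  · simp only [intervalIntegral.integral_const_mul, intervalIntegral_cos_mul ht, mul_sinc_mul ht]

/-- The probability measure whose density is the normalized Fejér kernel. -/
noncomputable def fejerMeasure : Measure ℝ :=
  volume.withDensity fun v => ENNReal.ofReal (fejerKernel v / ∫ u, fejerKernel u)

theorem fejerMeasure_real {s : Set ℝ} (hs : MeasurableSet s) :
    fejerMeasure.real s = (∫ v in s, fejerKernel v) / ∫ u, fejerKernel u := by
  rw [measureReal_def, fejerMeasure, withDensity_apply _ hs,
    ← ofReal_integral_eq_lintegral_ofReal (integrable_fejerKernel.div_const _).integrableOn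
      (ae_of_all _ fun v => div_nonneg (fejerKernel_nonneg v) integral_fejerKernel_pos.le),
    integral_div, ENNReal.toReal_ofReal]
  exact div_nonneg (setIntegral_nonneg hs fun v _ => fejerKernel_nonneg v)
    integral_fejerKernel_pos.le

instance : IsProbabilityMeasure fejerMeasure := by
  rw [isProbabilityMeasure_iff_real, fejerMeasure_real MeasurableSet.univ, Measure.restrict_univ,
    div_self integral_fejerKernel_pos.ne']

theorem fejerMeasure_real_Iio (b : ℝ) :
    fejerMeasure.real (Set.Iio b) = fejerMeasure.real (Set.Iio 0) +
      (∫ t in (0 : ℝ)..1, (1 - t) * (b * Real.sinc (t * b))) / ∫ u, fejerKernel u := by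
  rw [fejerMeasure_real measurableSet_Iio, fejerMeasure_real measurableSet_Iio,
    ← intervalIntegral_fejerKernel, ← add_div, ← integral_Iic_eq_integral_Iio,
    ← integral_Iic_eq_integral_Iio, ← intervalIntegral.integral_Iic_sub_Iic
      integrable_fejerKernel.integrableOn integrable_fejerKernel.integrableOn, add_sub_cancel]

theorem measureReal_conv_Iio (μ ν : Measure ℝ) [IsFiniteMeasure μ] [IsFiniteMeasure ν] (y : ℝ) :
    (μ ∗ ν).real (Set.Iio y) = ∫ s, ν.real (Set.Iio (y - s)) ∂μ := by
  have hmeas : Measurable fun s => ν (Set.Iio (y - s)) :=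
    Antitone.measurable fun a b hab => measure_mono (Set.Iio_subset_Iio (by linarith))
  simp only [measureReal_def]
  rw [integral_toReal hmeas.aemeasurable (ae_of_all _ fun _ => measure_lt_top _ _),
    ← lintegral_indicator_one measurableSet_Iio,
    Measure.lintegral_conv (measurable_one.indicator measurableSet_Iio)]
  congr 2 with s
  rw [← lintegral_indicator_one measurableSet_Iio]
  congr 1 with u
  simp only [Set.indicator, Set.mem_Iio, lt_sub_iff_add_lt', Pi.one_apply]

theorem integrable_fejer_integrand (μ : Measure ℝ) [IsFiniteMeasure μ] (hμ : Integrable id μ)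
    (y : ℝ) : Integrable (Function.uncurry fun t s : ℝ =>
      (1 - t) * ((y - s) * Real.sinc (t * (y - s))))
      ((volume.restrict (Set.uIoc (0 : ℝ) 1)).prod μ) := by
  have : IsFiniteMeasure (volume.restrict (Set.uIoc (0 : ℝ) 1)) := by
    rw [Set.uIoc_of_le zero_le_one]; infer_instance
  have := Real.measurable_sinc
  have hdom : Integrable (fun p : ℝ × ℝ => y - p.2)
      ((volume.restrict (Set.uIoc (0 : ℝ) 1)).prod μ) :=
    ((integrable_const y).sub hμ).comp_snd _
  refine hdom.norm.mono' (by unfold Function.uncurry; fun_prop) ?_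
  filter_upwards [Measure.quasiMeasurePreserving_fst.ae (ae_restrict_mem measurableSet_uIoc)]
    with ⟨t, s⟩ ht
  rw [Set.uIoc_of_le zero_le_one] at ht
  have hweight : |1 - t| ≤ 1 := abs_le.2 ⟨by linarith [ht.2], by linarith [ht.1]⟩
  calc ‖(1 - t) * ((y - s) * Real.sinc (t * (y - s)))‖
      = |1 - t| * (|y - s| * |Real.sinc (t * (y - s))|) := by simp only [norm_mul, Real.norm_eq_abs]
    _ ≤ 1 * (|y - s| * 1) := by gcongr; exact Real.abs_sinc_le_one _
    _ = ‖y - s‖ := by rw [one_mul, mul_one, Real.norm_eq_abs]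

theorem measureReal_conv_fejerMeasure_Iio (μ : Measure ℝ) [IsProbabilityMeasure μ]
    (hμ : Integrable id μ) (y : ℝ) :
    (μ ∗ fejerMeasure).real (Set.Iio y) = fejerMeasure.real (Set.Iio 0) +
      (∫ t in (0 : ℝ)..1, ∫ s, (1 - t) * ((y - s) * Real.sinc (t * (y - s))) ∂μ)
        / ∫ u, fejerKernel u := by
  have hint := integrable_fejer_integrand μ hμ y
  rw [measureReal_conv_Iio, intervalIntegral_integral_swap hint]
  simp only [fejerMeasure_real_Iio (y - _)]
  rw [integral_add (integrable_const _), integral_div, integral_const, probReal_univ, one_smul]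
  simp only [intervalIntegral.integral_of_le zero_le_one]
  rw [Set.uIoc_of_le zero_le_one] at hint
  exact hint.integral_prod_right.div_const _

theorem integral_sin_mul_sub (μ : Measure ℝ) [IsFiniteMeasure μ] (t y : ℝ) :
    ∫ s, Real.sin (t * (y - s)) ∂μ =
      (Complex.exp ((t * y : ℝ) * Complex.I) * charFun μ (-t)).im := by
  have hint : Integrable (fun s : ℝ => Complex.exp ((t * y : ℝ) * Complex.I) *
      Complex.exp ((-t : ℝ) * s * Complex.I)) μ := by
    refine (integrable_const (1 : ℝ)).mono' (by fun_prop) (ae_of_all _ fun s => ?_)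
    rw [norm_mul, Complex.norm_exp_ofReal_mul_I, ← Complex.ofReal_mul,
      Complex.norm_exp_ofReal_mul_I, mul_one]
  rw [charFun_apply_real, ← integral_const_mul, ← Complex.imCLM_apply,
    ← ContinuousLinearMap.integral_comp_comm _ hint]
  congr 1 with s
  rw [Complex.imCLM_apply, ← Complex.exp_add, ← Complex.ofReal_mul, ← add_mul,
    ← Complex.ofReal_add, Complex.exp_ofReal_mul_I_im]
  ring_nf

theorem abs_integral_sin_mul_sub_sub_le (μ ν : Measure ℝ) [IsFiniteMeasure μ] [IsFiniteMeasure ν]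
    (t y : ℝ) :
    |∫ s, Real.sin (t * (y - s)) ∂μ - ∫ s, Real.sin (t * (y - s)) ∂ν| ≤
      ‖charFun μ t - charFun ν t‖ := by
  rw [integral_sin_mul_sub, integral_sin_mul_sub, ← Complex.sub_im, ← mul_sub, charFun_neg,
    charFun_neg, ← map_sub]
  refine (Complex.abs_im_le_norm _).trans ?_
  rw [norm_mul, Complex.norm_exp_ofReal_mul_I, one_mul, RCLike.norm_conj]

theorem norm_charFun_sub_one_le (μ : Measure ℝ) [IsProbabilityMeasure μ] (hμ : Integrable id μ)
    (t : ℝ) : ‖charFun μ t - 1‖ ≤ |t| * ∫ s, |s| ∂μ := by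
  have hint : Integrable (fun s : ℝ => Complex.exp (t * s * Complex.I)) μ := by
    refine (integrable_const (1 : ℝ)).mono' (by fun_prop) (ae_of_all _ fun s => ?_)
    rw [← Complex.ofReal_mul, Complex.norm_exp_ofReal_mul_I]
  have hsub : charFun μ t - 1 = ∫ s : ℝ, (Complex.exp (t * s * Complex.I) - 1) ∂μ := by
    rw [integral_sub hint (integrable_const _), charFun_apply_real, integral_const, probReal_univ,
      one_smul]
  rw [hsub, ← integral_const_mul]
  refine norm_integral_le_of_norm_le (hμ.abs.const_mul |t|) (ae_of_all _ fun s => ?_)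
  rw [← Complex.ofReal_mul, mul_comm, ← abs_mul, ← Real.norm_eq_abs]
  exact Real.norm_exp_I_mul_ofReal_sub_one_le

theorem intervalIntegrable_norm_charFun_sub_div (μ ν : Measure ℝ) [IsProbabilityMeasure μ]
    [IsProbabilityMeasure ν] (hμ : Integrable id μ) (hν : Integrable id ν) (a b : ℝ) :
    IntervalIntegrable (fun t => ‖charFun μ t - charFun ν t‖ / t) volume a b := by
  refine (intervalIntegrable_const (c := ∫ s, |s| ∂μ + ∫ s, |s| ∂ν)).mono_fun
    ((measurable_charFun.sub measurable_charFun).norm.div measurable_id).aestronglyMeasurable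
    (ae_of_all _ fun t => ?_)
  have hmean : 0 ≤ ∫ s, |s| ∂μ + ∫ s, |s| ∂ν :=
    add_nonneg (integral_nonneg fun _ => abs_nonneg _) (integral_nonneg fun _ => abs_nonneg _)
  simp only [norm_div, Real.norm_of_nonneg hmean, Real.norm_eq_abs, abs_norm]
  refine div_le_of_le_mul₀ (abs_nonneg t) hmean ?_
  calc ‖charFun μ t - charFun ν t‖ ≤ ‖charFun μ t - 1‖ + ‖charFun ν t - 1‖ := by
        simpa using norm_sub_le (charFun μ t - 1) (charFun ν t - 1)
    _ ≤ (∫ s, |s| ∂μ + ∫ s, |s| ∂ν) * |t| := by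
        rw [mul_comm, mul_add]
        exact add_le_add (norm_charFun_sub_one_le μ hμ t) (norm_charFun_sub_one_le ν hν t)

theorem abs_fejer_integrand_sub_le (μ ν : Measure ℝ) [IsFiniteMeasure μ] [IsFiniteMeasure ν]
    (y : ℝ) {t : ℝ} (ht : t ∈ Set.Ioc 0 1) :
    |∫ s, (1 - t) * ((y - s) * Real.sinc (t * (y - s))) ∂μ -
        ∫ s, (1 - t) * ((y - s) * Real.sinc (t * (y - s))) ∂ν| ≤
      ‖charFun μ t - charFun ν t‖ / t := by
  simp only [integral_const_mul, mul_sinc_mul ht.1.ne', integral_div]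
  rw [← mul_sub, ← sub_div, abs_mul, abs_div, abs_of_pos ht.1]
  have hweight : |1 - t| ≤ 1 := abs_le.2 ⟨by linarith [ht.2], by linarith [ht.1]⟩
  refine (mul_le_of_le_one_left (div_nonneg (abs_nonneg _) ht.1.le) hweight).trans ?_
  gcongr
  · exact ht.1.le
  · exact abs_integral_sin_mul_sub_sub_le μ ν t y

theorem abs_conv_fejerMeasure_Iio_sub_le (μ ν : Measure ℝ) [IsProbabilityMeasure μ]
    [IsProbabilityMeasure ν] (hμ : Integrable id μ) (hν : Integrable id ν) (y : ℝ) :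
    |(μ ∗ fejerMeasure).real (Set.Iio y) - (ν ∗ fejerMeasure).real (Set.Iio y)| ≤
      (∫ t in (0 : ℝ)..1, ‖charFun μ t - charFun ν t‖ / t) / ∫ u, fejerKernel u := by
  have hint : ∀ ρ : Measure ℝ, IsProbabilityMeasure ρ → Integrable id ρ → IntervalIntegrable
      (fun t => ∫ s, (1 - t) * ((y - s) * Real.sinc (t * (y - s))) ∂ρ) volume 0 1 :=
    fun ρ _ hρ => intervalIntegrable_iff.2 (integrable_fejer_integrand ρ hρ y).integral_prod_left
  rw [measureReal_conv_fejerMeasure_Iio μ hμ, measureReal_conv_fejerMeasure_Iio ν hν,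
    add_sub_add_left_eq_sub, ← sub_div, abs_div, abs_of_pos integral_fejerKernel_pos,
    ← intervalIntegral.integral_sub (hint μ inferInstance hμ) (hint ν inferInstance hν)]
  refine div_le_div_of_nonneg_right ?_ integral_fejerKernel_pos.le
  rw [← Real.norm_eq_abs]
  exact intervalIntegral.norm_integral_le_of_norm_le zero_le_one
    (ae_of_all _ fun t ht => abs_fejer_integrand_sub_le μ ν y ht)
    (intervalIntegrable_norm_charFun_sub_div μ ν hμ hν 0 1)

theorem exists_measureReal_compl_closedBall_le (κ : Measure ℝ) [IsFiniteMeasure κ] {ε : ℝ}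
    (hε : 0 < ε) : ∃ a : ℝ, 0 < a ∧ κ.real (Metric.closedBall 0 a)ᶜ ≤ ε := by
  have htight := tendsto_measure_compl_closedBall_of_isTightMeasureSet
    (isTightMeasureSet_singleton (μ := κ)) 0
  simp only [Set.mem_singleton_iff, iSup_iSup_eq_left] at htight
  obtain ⟨a, ha, ha0⟩ := ((htight.eventually_le_const (ENNReal.ofReal_pos.2 hε)).and
    (eventually_gt_atTop 0)).exists
  exact ⟨a, ha0, ENNReal.toReal_le_of_le_ofReal hε.le ha⟩

theorem le_of_integral_translate_le {κ : Measure ℝ} [IsProbabilityMeasure κ] {a : ℝ} (ha : 0 ≤ a)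
    (hκ : κ.real (Metric.closedBall 0 a)ᶜ ≤ 1 / 4) {δ : ℝ → ℝ} {l : NNReal} {D J : ℝ}
    (hD : ∀ y, |δ y| ≤ D) (hmono : Monotone fun y => δ y + l * y)
    (hJ : ∀ y, ∫ u, δ (y - u) ∂κ ≤ J) (y : ℝ) : δ y ≤ D / 2 + J + 2 * a * l := by
  set b := δ y - 2 * a * l
  set s := (Metric.closedBall (0 : ℝ) a)ᶜ
  have hs : MeasurableSet s := Metric.isClosed_closedBall.measurableSet.compl
  have hδ : Measurable δ := by
    simpa [Pi.sub_def] using hmono.measurable.sub (measurable_id.const_mul (l : ℝ))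
  have hint : Integrable (fun u => δ (y + a - u)) κ :=
    (integrable_const D).mono' (hδ.comp (by fun_prop)).aestronglyMeasurable
      (ae_of_all _ fun u => hD _)
  have hlower : ∀ u, b - s.indicator (fun _ => D + b) u ≤ δ (y + a - u) := by
    intro u
    by_cases hu : u ∈ s
    · rw [Set.indicator_of_mem hu]
      linarith [(abs_le.1 (hD (y + a - u))).1]
    · rw [Set.indicator_of_notMem hu, sub_zero]
      have hua : |u| ≤ a := by simpa [s] using hu
      have hmon := hmono (show y ≤ y + a - u by linarith [le_abs_self u])
      simp only [b] at hmon ⊢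
      nlinarith [l.coe_nonneg, neg_abs_le u]
  have hb : b - κ.real s * (D + b) ≤ J :=
    calc b - κ.real s * (D + b) = ∫ u, (b - s.indicator (fun _ => D + b) u) ∂κ := by
          rw [integral_sub (integrable_const _) ((integrable_const _).indicator hs),
            integral_indicator_const _ hs, integral_const, probReal_univ, one_smul, smul_eq_mul]
      _ ≤ ∫ u, δ (y + a - u) ∂κ :=
          integral_mono ((integrable_const _).sub ((integrable_const _).indicator hs)) hint hlower
      _ ≤ J := hJ _
  have hbD : b ≤ D := by
    have : 0 ≤ 2 * a * l := by positivity
    linarith [(abs_le.1 (hD y)).2]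
  have hD0 : 0 ≤ D := (abs_nonneg _).trans (hD y)
  nlinarith [measureReal_nonneg (μ := κ) (s := s)]

theorem abs_le_of_abs_integral_translate_le {κ : Measure ℝ} [IsProbabilityMeasure κ] {a : ℝ}
    (ha : 0 ≤ a) (hκ : κ.real (Metric.closedBall 0 a)ᶜ ≤ 1 / 4) {δ : ℝ → ℝ} {l : NNReal} {J : ℝ}
    (hbdd : BddAbove (Set.range fun y => |δ y|)) (hmono : Monotone fun y => δ y + l * y)
    (hJ : ∀ y, |∫ u, δ (y - u) ∂κ| ≤ J) (y : ℝ) : |δ y| ≤ 2 * J + 4 * a * l := by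
  set D := ⨆ y, |δ y|
  have hD : ∀ y, |δ y| ≤ D := le_ciSup hbdd
  have hneg : ∀ y, -δ y ≤ D / 2 + J + 2 * a * l := by
    have : IsProbabilityMeasure (κ.map Neg.neg) :=
      Measure.isProbabilityMeasure_map measurable_neg.aemeasurable
    intro y
    rw [← neg_neg y]
    refine le_of_integral_translate_le (κ := κ.map Neg.neg) (δ := fun y => -δ (-y)) ha ?_
      (fun y => by simpa using hD (-y)) (fun u v huv => ?_) (fun y => ?_) (-y)
    · rw [map_measureReal_apply measurable_neg Metric.isClosed_closedBall.measurableSet.compl]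
      simpa using hκ
    · have := hmono (neg_le_neg huv)
      simp only at this ⊢
      linarith
    · change ∫ u, -δ (-(y - u)) ∂κ.map (MeasurableEquiv.neg ℝ) ≤ J
      rw [integral_map_equiv, integral_neg, neg_le]
      simpa [sub_eq_add_neg, add_comm] using (abs_le.1 (hJ (-y))).1
  have hsup : D ≤ D / 2 + J + 2 * a * l := ciSup_le fun y => abs_le'.2
    ⟨le_of_integral_translate_le ha hκ hD hmono (fun y => (abs_le.1 (hJ y)).2) y, hneg y⟩
  linarith [hD y]

theorem abs_measureReal_sub_le_one {α : Type*} [MeasurableSpace α] (μ ν : Measure α)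
    [IsProbabilityMeasure μ] [IsProbabilityMeasure ν] (s : Set α) :
    |μ.real s - ν.real s| ≤ 1 :=
  abs_sub_le_of_nonneg_of_le measureReal_nonneg measureReal_le_one measureReal_nonneg
    measureReal_le_one

theorem monotone_measureReal_Iio_sub_add (μ : Measure ℝ) [IsFiniteMeasure μ] {ν : Measure ℝ}
    [IsFiniteMeasure ν] {l : NNReal} (hν : ν ≤ l • volume) :
    Monotone fun y => μ.real (Set.Iio y) - ν.real (Set.Iio y) + l * y := by
  intro y z hyz
  have hμ : μ.real (Set.Iio y) ≤ μ.real (Set.Iio z) := measureReal_mono (Set.Iio_subset_Iio hyz)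
  have hIco : ν.real (Set.Ico y z) ≤ l * (z - y) := by
    refine ENNReal.toReal_le_of_le_ofReal (by nlinarith [l.coe_nonneg]) ?_
    refine (hν _).trans_eq ?_
    rw [Measure.smul_apply, Real.volume_Ico, ENNReal.smul_def, smul_eq_mul,
      ENNReal.ofReal_mul l.coe_nonneg, ENNReal.ofReal_coe_nnreal]
  have hsplit : ν.real (Set.Iio z) = ν.real (Set.Iio y) + ν.real (Set.Ico y z) := by
    rw [← Set.Iio_union_Ico_eq_Iio hyz, measureReal_union _ measurableSet_Ico]
    exact Set.disjoint_left.2 fun u hu hu' => not_le.2 hu hu'.1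
  simp only
  linarith

theorem exists_abs_measureReal_Iio_sub_le : ∃ C : ℝ, 0 < C ∧ ∀ (μ ν : Measure ℝ)
    [IsProbabilityMeasure μ] [IsProbabilityMeasure ν], Integrable id μ → Integrable id ν →
    ∀ l : NNReal, ν ≤ l • volume → ∀ y, |μ.real (Set.Iio y) - ν.real (Set.Iio y)| ≤
      C * ((∫ t in (0 : ℝ)..1, ‖charFun μ t - charFun ν t‖ / t) + l) := by
  obtain ⟨a, ha, hκ⟩ :=
    exists_measureReal_compl_closedBall_le fejerMeasure (ε := 1 / 4) (by norm_num)
  set c := ∫ v, fejerKernel v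
  have hc : 0 < c := integral_fejerKernel_pos
  refine ⟨2 / c + 4 * a, by positivity, fun μ ν _ _ hμ hν l hl y => ?_⟩
  set I := ∫ t in (0 : ℝ)..1, ‖charFun μ t - charFun ν t‖ / t
  have hI : 0 ≤ I := intervalIntegral.integral_nonneg zero_le_one fun t ht =>
    div_nonneg (norm_nonneg _) ht.1
  have hsmooth : ∀ y, |∫ u, (μ.real (Set.Iio (y - u)) - ν.real (Set.Iio (y - u))) ∂fejerMeasure|
      ≤ I / c := by
    have hint : ∀ ρ : Measure ℝ, IsProbabilityMeasure ρ → ∀ y,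
        Integrable (fun u => ρ.real (Set.Iio (y - u))) fejerMeasure := fun ρ _ y =>
      (integrable_const (1 : ℝ)).mono' (Antitone.measurable fun u v huv => measureReal_mono
        (Set.Iio_subset_Iio (by linarith))).aestronglyMeasurable
        (ae_of_all _ fun u => by
          simp only [Real.norm_eq_abs, abs_of_nonneg measureReal_nonneg, measureReal_le_one])
    intro y
    rw [integral_sub (hint μ inferInstance y) (hint ν inferInstance y), ← measureReal_conv_Iio,
      ← measureReal_conv_Iio, Measure.conv_comm fejerMeasure, Measure.conv_comm fejerMeasure]
    exact abs_conv_fejerMeasure_Iio_sub_le μ ν hμ hν y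
  calc |μ.real (Set.Iio y) - ν.real (Set.Iio y)| ≤ 2 * (I / c) + 4 * a * l :=
        abs_le_of_abs_integral_translate_le ha.le hκ
          ⟨1, Set.forall_mem_range.2 fun y => abs_measureReal_sub_le_one μ ν _⟩
          (monotone_measureReal_Iio_sub_add μ hl) hsmooth y
    _ ≤ 2 * (I / c) + 4 * a * l + (4 * a * I + 2 / c * l) :=
        le_add_of_nonneg_right (by positivity)
    _ = (2 / c + 4 * a) * (I + l) := by ring

theorem map_mul_left_le_smul_volume {ν : Measure ℝ} {l : NNReal} (hν : ν ≤ l • volume) {T : ℝ}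
    (hT : 0 < T) : ν.map (T * ·) ≤ (l / T.toNNReal) • volume := by
  refine (Measure.map_mono hν (measurable_const_mul T)).trans_eq ?_
  rw [Measure.map_smul, Real.map_volume_mul_left hT.ne', abs_of_pos (inv_pos.2 hT),
    div_eq_mul_inv, mul_smul, ENNReal.ofReal, Real.toNNReal_inv]
  rfl

theorem exists_esseen_smoothing : ∃ C : ℝ, 0 < C ∧ ∀ (μ ν : Measure ℝ) [IsProbabilityMeasure μ]
    [IsProbabilityMeasure ν], Integrable id μ → Integrable id ν →
    ∀ l : NNReal, ν ≤ l • volume → ∀ T : ℝ, 0 < T → ∀ y,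
      |μ.real (Set.Iio y) - ν.real (Set.Iio y)| ≤
        C * ((∫ t in (0 : ℝ)..T, ‖charFun μ t - charFun ν t‖ / t) + l / T) := by
  obtain ⟨C, hC, hsmooth⟩ := exists_abs_measureReal_Iio_sub_le
  refine ⟨C, hC, fun μ ν _ _ hμ hν l hl T hT y => ?_⟩
  have hmul : Measurable (T * · : ℝ → ℝ) := measurable_const_mul T
  have := Measure.isProbabilityMeasure_map (μ := μ) hmul.aemeasurable
  have := Measure.isProbabilityMeasure_map (μ := ν) hmul.aemeasurable
  have hid : ∀ ρ : Measure ℝ, Integrable id ρ → Integrable id (ρ.map (T * ·)) := fun ρ hρ =>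
    (integrable_map_measure measurable_id.aestronglyMeasurable hmul.aemeasurable).2
      (hρ.const_mul T)
  have hIio : ∀ ρ : Measure ℝ, (ρ.map (T * ·)).real (Set.Iio (T * y)) = ρ.real (Set.Iio y) := by
    intro ρ
    rw [map_measureReal_apply hmul measurableSet_Iio, Set.preimage_const_mul_Iio₀ _ hT,
      mul_div_cancel_left₀ _ hT.ne']
  have hcharFun : (∫ t in (0 : ℝ)..1, ‖charFun (μ.map (T * ·)) t - charFun (ν.map (T * ·)) t‖ / t)
      = ∫ t in (0 : ℝ)..T, ‖charFun μ t - charFun ν t‖ / t := by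
    have := intervalIntegral.integral_comp_mul_left
      (fun t => ‖charFun μ t - charFun ν t‖ / t) hT.ne' (a := 0) (b := 1)
    simp only [charFun_map_mul]
    rw [mul_zero, mul_one, eq_inv_smul_iff₀ hT.ne', ← intervalIntegral.integral_smul] at this
    rw [← this]
    congr 1 with t
    rw [smul_eq_mul, ← mul_div_assoc, mul_div_mul_left _ _ hT.ne']
  have := hsmooth (μ.map (T * ·)) (ν.map (T * ·)) (hid μ hμ) (hid ν hν) _
    (map_mul_left_le_smul_volume hl hT) (T * y)
  rwa [hIio, hIio, hcharFun, NNReal.coe_div, Real.coe_toNNReal _ hT.le] at this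

/-! ### Laplace transforms of half-line Gaussian laws -/

theorem integral_eq_setIntegral_Ioo_measureReal_lt {α : Type*} [MeasurableSpace α] {μ : Measure α}
    {f : α → ℝ} (hf : Integrable f μ) (hf0 : ∀ y, 0 ≤ f y) (hf1 : ∀ y, f y ≤ 1) :
    ∫ y, f y ∂μ = ∫ t in Set.Ioo (0 : ℝ) 1, μ.real {y | t < f y} := by
  rw [hf.integral_eq_integral_meas_lt (ae_of_all _ hf0)]
  refine setIntegral_eq_of_subset_of_forall_sdiff_eq_zero measurableSet_Ioi
    Set.Ioo_subset_Ioi_self fun t ht => ?_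
  have ht1 : 1 ≤ t := not_lt.1 fun h => ht.2 ⟨ht.1, h⟩
  have hempty : {y | t < f y} = ∅ :=
    Set.eq_empty_of_forall_notMem fun y hy => absurd (hf1 y) (not_le.2 (ht1.trans_lt hy))
  rw [hempty, measureReal_empty]

theorem abs_integral_sub_le_of_abs_measureReal_lt_sub_le {α : Type*} [MeasurableSpace α]
    (μ ν : Measure α) [IsFiniteMeasure μ] [IsFiniteMeasure ν] {f : α → ℝ} (hf : Measurable f)
    (hf0 : ∀ y, 0 ≤ f y) (hf1 : ∀ y, f y ≤ 1) {ε : ℝ}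
    (h : ∀ t ∈ Set.Ioo (0 : ℝ) 1, |μ.real {y | t < f y} - ν.real {y | t < f y}| ≤ ε) :
    |∫ y, f y ∂μ - ∫ y, f y ∂ν| ≤ ε := by
  have hint : ∀ ρ : Measure α, IsFiniteMeasure ρ → Integrable f ρ := fun ρ _ =>
    (integrable_const (1 : ℝ)).mono' hf.aestronglyMeasurable
      (ae_of_all _ fun y => by rw [Real.norm_of_nonneg (hf0 y)]; exact hf1 y)
  have hdist : ∀ ρ : Measure α, IsFiniteMeasure ρ →
      IntegrableOn (fun t => ρ.real {y | t < f y}) (Set.Ioo (0 : ℝ) 1) := fun ρ _ =>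
    (integrable_const (ρ.real Set.univ)).mono' (Antitone.measurable fun s t hst =>
      measureReal_mono fun y (hy : t < f y) => lt_of_le_of_lt hst hy).aestronglyMeasurable
      (ae_of_all _ fun t => by
        rw [Real.norm_of_nonneg measureReal_nonneg]
        exact measureReal_mono (Set.subset_univ _))
  rw [integral_eq_setIntegral_Ioo_measureReal_lt (hint μ inferInstance) hf0 hf1,
    integral_eq_setIntegral_Ioo_measureReal_lt (hint ν inferInstance) hf0 hf1,
    ← integral_sub (hdist μ inferInstance) (hdist ν inferInstance), ← Real.norm_eq_abs]
  refine (norm_setIntegral_le_of_norm_le_const (by simp) h).trans_eq ?_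
  rw [Real.volume_real_Ioo_of_le zero_le_one, sub_zero, mul_one]

/-- The function `y ↦ e^{-x (y - a)}` on `[a, ∞)`, extended by zero: the factor that undoes an
exponential change of measure with parameter `x` on the tail `[a, ∞)`. -/
noncomputable def expTail (x a y : ℝ) : ℝ :=
  (Set.Ici a).indicator (fun y => Real.exp (-(x * (y - a)))) y

theorem expTail_nonneg (x a y : ℝ) : 0 ≤ expTail x a y :=
  Set.indicator_nonneg (fun _ _ => (Real.exp_pos _).le) y

theorem expTail_le_one {x : ℝ} (hx : 0 ≤ x) (a y : ℝ) : expTail x a y ≤ 1 := by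
  refine Set.indicator_le' (g := fun _ => 1) (fun y hy => ?_) (fun _ _ => zero_le_one) y
  rw [Real.exp_le_one_iff, neg_nonpos]
  exact mul_nonneg hx (sub_nonneg.2 hy)

theorem measurable_expTail (x a : ℝ) : Measurable (expTail x a) :=
  Measurable.indicator (by fun_prop) measurableSet_Ici

theorem setOf_lt_expTail {x t : ℝ} (hx : 0 < x) (a : ℝ) (ht : 0 < t) :
    {y | t < expTail x a y} = Set.Iio (a - Real.log t / x) \ Set.Iio a := by
  ext y
  simp only [expTail, Set.indicator, Set.mem_Ici, Set.mem_ofPred_eq, Set.mem_sdiff, Set.mem_Iio,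
    not_lt]
  by_cases hy : a ≤ y
  · simp only [hy, if_true, and_true]
    rw [← Real.log_lt_iff_lt_exp ht, lt_sub_comm, div_lt_iff₀ hx, ← mul_neg, neg_sub, mul_comm]
  · simp [hy, ht.le]

theorem setOf_lt_expTail_zero {t : ℝ} (a : ℝ) (ht : t ∈ Set.Ioo (0 : ℝ) 1) :
    {y | t < expTail 0 a y} = Set.univ \ Set.Iio a := by
  ext y
  by_cases hy : a ≤ y <;> simp [expTail, Set.indicator, hy, ht.1.le, ht.2]

theorem abs_integral_expTail_sub_le (μ ν : Measure ℝ) [IsProbabilityMeasure μ]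
    [IsProbabilityMeasure ν] {ε : ℝ}
    (h : ∀ y, |μ.real (Set.Iio y) - ν.real (Set.Iio y)| ≤ ε) {x : ℝ} (hx : 0 ≤ x) (a : ℝ) :
    |∫ y, expTail x a y ∂μ - ∫ y, expTail x a y ∂ν| ≤ 2 * ε := by
  have hε : 0 ≤ ε := (abs_nonneg _).trans (h a)
  have hdiff : ∀ s : Set ℝ, Set.Iio a ⊆ s → |μ.real s - ν.real s| ≤ ε →
      |μ.real (s \ Set.Iio a) - ν.real (s \ Set.Iio a)| ≤ 2 * ε := by
    intro s has hs
    rw [measureReal_sdiff has measurableSet_Iio, measureReal_sdiff has measurableSet_Iio,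
      sub_sub_sub_comm, two_mul]
    exact (abs_sub _ _).trans (add_le_add hs (h a))
  refine abs_integral_sub_le_of_abs_measureReal_lt_sub_le μ ν (measurable_expTail x a)
    (expTail_nonneg x a) (expTail_le_one hx a) fun t ht => ?_
  rcases hx.eq_or_lt with rfl | hx
  · rw [setOf_lt_expTail_zero a ht]
    exact hdiff _ (Set.subset_univ _) (by simpa using hε)
  · rw [setOf_lt_expTail hx a ht.1]
    refine hdiff _ (Set.Iio_subset_Iio ?_) (h _)
    rw [le_sub_self_iff]
    exact div_nonpos_of_nonpos_of_nonneg (Real.log_nonpos ht.1.le ht.2.le) hx.le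

theorem gaussianPDFReal_le_one (m : ℝ) {v : NNReal} (hv : 1 / 2 ≤ v) (y : ℝ) :
    gaussianPDFReal m v y ≤ 1 := by
  have hv' : (1 / 2 : ℝ) ≤ v := by exact_mod_cast hv
  have hsqrt : 1 ≤ √(2 * Real.pi * v) := by
    rw [Real.one_le_sqrt]
    nlinarith [Real.pi_gt_three, hv']
  refine mul_le_one₀ (inv_le_one_of_one_le₀ hsqrt) (Real.exp_pos _).le ?_
  rw [Real.exp_le_one_iff]
  exact div_nonpos_of_nonpos_of_nonneg (neg_nonpos.2 (sq_nonneg _)) (by positivity)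

theorem gaussianReal_le_volume (m : ℝ) {v : NNReal} (hv : 1 / 2 ≤ v) :
    gaussianReal m v ≤ volume := by
  have hv0 : v ≠ 0 := (lt_of_lt_of_le (by norm_num) hv).ne'
  rw [gaussianReal_of_var_ne_zero m hv0]
  calc volume.withDensity (gaussianPDF m v) ≤ volume.withDensity 1 :=
        withDensity_mono (ae_of_all _ fun y =>
          ENNReal.ofReal_le_one.2 (gaussianPDFReal_le_one m hv y))
    _ = volume := withDensity_one

/-- The Laplace transform at `x` of the restriction to `(0, ∞)` of a Gaussian law. At `m = 0`,
`v = 1` it is the Mills ratio of the standard normal law, divided by `√(2π)`. -/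
noncomputable def gaussianHalfLaplace (m : ℝ) (v : NNReal) (x : ℝ) : ℝ :=
  ∫ w in Set.Ioi (0 : ℝ), Real.exp (-(x * w)) * gaussianPDFReal m v w

theorem integrableOn_exp_mul_gaussianPDFReal (m : ℝ) (v : NNReal) {x : ℝ} (hx : 0 ≤ x) :
    IntegrableOn (fun w => Real.exp (-(x * w)) * gaussianPDFReal m v w) (Set.Ioi 0) := by
  refine (integrable_gaussianPDFReal m v).integrableOn.mono' (by fun_prop) ?_
  filter_upwards [ae_restrict_mem measurableSet_Ioi] with w hw
  rw [norm_mul, Real.norm_of_nonneg (Real.exp_pos _).le,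
    Real.norm_of_nonneg (gaussianPDFReal_nonneg _ _ _)]
  refine mul_le_of_le_one_left (gaussianPDFReal_nonneg _ _ _) ?_
  rw [Real.exp_le_one_iff, neg_nonpos]
  exact mul_nonneg hx (le_of_lt hw)

theorem integral_expTail_gaussianReal (m a x : ℝ) {v : NNReal} (hv : v ≠ 0) :
    ∫ y, expTail x a y ∂(gaussianReal m v) = gaussianHalfLaplace (m - a) v x := by
  rw [integral_gaussianReal_eq_integral_smul hv, gaussianHalfLaplace,
    ← integral_add_right_eq_self _ a, ← integral_Ici_eq_integral_Ioi,
    ← integral_indicator measurableSet_Ici]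
  congr with w
  simp only [expTail, Set.indicator, Set.mem_Ici, le_add_iff_nonneg_left, smul_eq_mul,
    gaussianPDFReal_add, add_sub_cancel_right, mul_ite, mul_comm, zero_mul]

theorem one_sub_stdNormalDF (x : ℝ) :
    1 - stdNormalDF x = Real.exp (-x ^ 2 / 2) * gaussianHalfLaplace 0 1 x := by
  have hpre : Set.Ioi (0 : ℝ) = (fun w => w + x) ⁻¹' Set.Ioi x := by
    ext w; simp
  rw [stdNormalDF, cdf_eq_real, ← probReal_compl_eq_one_sub measurableSet_Iic, Set.compl_Iic,
    measureReal_def, gaussianReal_apply_eq_integral 0 one_ne_zero, ENNReal.toReal_ofReal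
    (setIntegral_nonneg measurableSet_Ioi fun u _ => gaussianPDFReal_nonneg 0 1 u),
    gaussianHalfLaplace, ← integral_const_mul, hpre,
    ← (measurePreserving_add_right volume x).setIntegral_preimage_emb
      (measurableEmbedding_addRight x)]
  congr with w
  simp only [gaussianPDFReal, NNReal.coe_one]
  rw [mul_left_comm (Real.exp (-(x * w))), mul_left_comm, ← Real.exp_add, ← Real.exp_add]
  congr 2
  ring

theorem gaussianHalfLaplace_nonneg (m : ℝ) (v : NNReal) (x : ℝ) :
    0 ≤ gaussianHalfLaplace m v x :=
  setIntegral_nonneg measurableSet_Ioi fun w _ =>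
    mul_nonneg (Real.exp_pos _).le (gaussianPDFReal_nonneg m v w)

theorem integrableOn_exp_neg_mul {x : ℝ} (hx : 0 < x) :
    IntegrableOn (fun w => Real.exp (-(x * w))) (Set.Ioi 0) := by
  simpa only [neg_mul] using integrableOn_exp_mul_Ioi (neg_lt_zero.2 hx) 0

theorem setIntegral_exp_neg_mul {x : ℝ} (hx : 0 < x) :
    ∫ w in Set.Ioi (0 : ℝ), Real.exp (-(x * w)) = 1 / x := by
  simpa [neg_mul] using integral_exp_mul_Ioi (neg_lt_zero.2 hx) 0

theorem setIntegral_mul_exp_neg_mul {x : ℝ} (hx : 0 < x) :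
    ∫ w in Set.Ioi (0 : ℝ), w * Real.exp (-(x * w)) = 1 / x ^ 2 := by
  have hGamma := Real.integral_rpow_mul_exp_neg_mul_Ioi (a := 2) two_pos hx
  norm_num at hGamma
  simpa using hGamma

theorem integrableOn_mul_exp_neg_mul {x : ℝ} (hx : 0 < x) :
    IntegrableOn (fun w => w * Real.exp (-(x * w))) (Set.Ioi 0) :=
  Integrable.of_integral_ne_zero <| by
    rw [setIntegral_mul_exp_neg_mul hx]
    positivity

theorem mul_gaussianHalfLaplace_le_one (m : ℝ) {v : NNReal} (hv : 1 / 2 ≤ v) {x : ℝ}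
    (hx : 0 ≤ x) : x * gaussianHalfLaplace m v x ≤ 1 := by
  rcases hx.eq_or_lt with rfl | hx
  · simp
  rw [mul_comm, ← le_div_iff₀ hx, ← setIntegral_exp_neg_mul hx]
  exact setIntegral_mono_on (integrableOn_exp_mul_gaussianPDFReal m v hx.le)
    (integrableOn_exp_neg_mul hx) measurableSet_Ioi fun w _ =>
      mul_le_of_le_one_right (Real.exp_pos _).le (gaussianPDFReal_le_one m hv w)

theorem abs_exp_sub_exp_le {a b c : ℝ} (ha : a ≤ c) (hb : b ≤ c) :
    |Real.exp a - Real.exp b| ≤ |a - b| * Real.exp c := by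
  wlog h : b ≤ a generalizing a b
  · rw [abs_sub_comm, abs_sub_comm a]
    exact this hb ha (le_of_not_ge h)
  rw [abs_of_nonneg (sub_nonneg.2 (Real.exp_le_exp.2 h)), abs_of_nonneg (sub_nonneg.2 h)]
  calc Real.exp a - Real.exp b = (1 - Real.exp (b - a)) * Real.exp a := by
        rw [Real.exp_sub]; field_simp
    _ ≤ (a - b) * Real.exp c :=
        mul_le_mul (by linarith [Real.add_one_le_exp (b - a)]) (Real.exp_le_exp.2 ha)
          (Real.exp_pos _).le (sub_nonneg.2 h)

/-- The exponent of the Gaussian density of mean `m` and variance `v`, with the normalisation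
`1 / √v` absorbed, so that densities of different variances can be compared through it. -/
noncomputable def gaussianLogDensity (m v w : ℝ) : ℝ :=
  -(w - m) ^ 2 / (2 * v) - Real.log v / 2

theorem gaussianPDFReal_eq_exp_gaussianLogDensity (m : ℝ) {v : NNReal} (hv : v ≠ 0) (w : ℝ) :
    gaussianPDFReal m v w = (√(2 * Real.pi))⁻¹ * Real.exp (gaussianLogDensity m v w) := by
  have hv' : (0 : ℝ) < v := by positivity
  rw [gaussianPDFReal, Real.sqrt_mul (by positivity), gaussianLogDensity, Real.exp_sub, mul_inv,
    Real.exp_half, Real.exp_log hv', mul_assoc, div_eq_inv_mul (Real.exp _)]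

theorem abs_log_le_two_mul_abs_sub_one {v : ℝ} (hv : 1 / 2 ≤ v) :
    |Real.log v| ≤ 2 * |v - 1| := by
  have hv0 : 0 < v := by linarith
  have hlower : -(2 * |v - 1|) ≤ 1 - v⁻¹ := by
    rw [show 1 - v⁻¹ = (v - 1) / v by field_simp, le_div_iff₀ hv0]
    nlinarith [neg_abs_le (v - 1), abs_nonneg (v - 1)]
  exact abs_le.2 ⟨hlower.trans (Real.one_sub_inv_le_log_of_pos hv0), by
    linarith [Real.log_le_sub_one_of_pos hv0, le_abs_self (v - 1), abs_nonneg (v - 1)]⟩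

theorem gaussianLogDensity_le {m v : ℝ} (hm : |m| ≤ 1 / 2) (hv : |v - 1| ≤ 1 / 2) (w : ℝ) :
    gaussianLogDensity m v w ≤ 1 - w ^ 2 / 6 := by
  obtain ⟨hvl, hvu⟩ := abs_le.1 hv
  have hquad : (w - m) ^ 2 / 3 ≤ (w - m) ^ 2 / (2 * v) := by
    gcongr <;> linarith
  have hlog := (abs_le.1 (abs_log_le_two_mul_abs_sub_one (by linarith : 1 / 2 ≤ v))).1
  rw [gaussianLogDensity, neg_div]
  nlinarith [sq_nonneg (w - 2 * m), abs_nonneg m, sq_abs m]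

theorem abs_gaussianLogDensity_sub_le (m : ℝ) {v w : ℝ} (hv : 1 / 2 ≤ v) (hw : 0 ≤ w) :
    |gaussianLogDensity m v w - gaussianLogDensity 0 1 w| ≤
      2 * |m| * w + m ^ 2 + |v - 1| * (1 + w ^ 2) := by
  have hdiff : gaussianLogDensity m v w - gaussianLogDensity 0 1 w =
      (2 * m * w - m ^ 2 + (v - 1) * w ^ 2) / (2 * v) - Real.log v / 2 := by
    simp only [gaussianLogDensity, Real.log_one]
    field_simp
    ring
  have hnum : |2 * m * w - m ^ 2 + (v - 1) * w ^ 2| ≤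
      2 * |m| * w + m ^ 2 + |v - 1| * w ^ 2 := by
    refine (abs_add_le _ _).trans (add_le_add ((abs_sub _ _).trans_eq ?_) (le_of_eq ?_))
    · rw [abs_mul, abs_mul, abs_of_nonneg hw, abs_two, abs_sq]
    · rw [abs_mul, abs_sq]
  have hquot : |(2 * m * w - m ^ 2 + (v - 1) * w ^ 2) / (2 * v)| ≤
      2 * |m| * w + m ^ 2 + |v - 1| * w ^ 2 := by
    rw [abs_div, abs_of_pos (by linarith : 0 < 2 * v)]
    exact (div_le_self (abs_nonneg _) (by linarith)).trans hnum
  rw [hdiff]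
  refine (abs_sub _ _).trans ?_
  rw [abs_div (Real.log v), abs_two]
  linarith [abs_log_le_two_mul_abs_sub_one hv]

theorem one_add_sq_mul_exp_le (w : ℝ) : (1 + w ^ 2) * Real.exp (1 - w ^ 2 / 6) ≤ 18 := by
  have hpoly : (1 + w ^ 2) * Real.exp (-(w ^ 2 / 6)) ≤ 6 := by
    rw [Real.exp_neg, mul_inv_le_iff₀ (Real.exp_pos _)]
    nlinarith [Real.add_one_le_exp (w ^ 2 / 6)]
  calc (1 + w ^ 2) * Real.exp (1 - w ^ 2 / 6)
      = (1 + w ^ 2) * Real.exp (-(w ^ 2 / 6)) * Real.exp 1 := by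
        rw [mul_assoc, ← Real.exp_add]; ring_nf
    _ ≤ 6 * 3 := by gcongr; exact Real.exp_one_lt_three.le
    _ = 18 := by norm_num

theorem abs_gaussianPDFReal_sub_le {m : ℝ} {v : NNReal} (hm : |m| ≤ 1 / 2)
    (hv : |(v : ℝ) - 1| ≤ 1 / 2) {w : ℝ} (hw : 0 ≤ w) :
    |gaussianPDFReal m v w - gaussianPDFReal 0 1 w| ≤
      3 * (2 * |m| * w + (m ^ 2 + 6 * |(v : ℝ) - 1|)) := by
  have hv2 : (1 / 2 : ℝ) ≤ v := by linarith [(abs_le.1 hv).1]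
  have hv0 : v ≠ 0 := by rintro rfl; norm_num at hv2
  have hpi : (√(2 * Real.pi))⁻¹ ≤ 1 := by
    refine inv_le_one_of_one_le₀ ?_
    rw [Real.one_le_sqrt]
    linarith [Real.pi_gt_three]
  have hexp : Real.exp (1 - w ^ 2 / 6) ≤ 3 :=
    (Real.exp_le_exp.2 (by linarith [sq_nonneg w])).trans Real.exp_one_lt_three.le
  rw [gaussianPDFReal_eq_exp_gaussianLogDensity m hv0,
    gaussianPDFReal_eq_exp_gaussianLogDensity 0 one_ne_zero, NNReal.coe_one, ← mul_sub, abs_mul,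
    abs_of_pos (by positivity)]
  refine (mul_le_of_le_one_left (abs_nonneg _) hpi).trans ?_
  calc |Real.exp (gaussianLogDensity m v w) - Real.exp (gaussianLogDensity 0 1 w)|
      ≤ |gaussianLogDensity m v w - gaussianLogDensity 0 1 w| * Real.exp (1 - w ^ 2 / 6) :=
        abs_exp_sub_exp_le (gaussianLogDensity_le hm hv w)
          (gaussianLogDensity_le (by norm_num) (by norm_num) w)
    _ ≤ (2 * |m| * w + m ^ 2 + |(v : ℝ) - 1| * (1 + w ^ 2)) * Real.exp (1 - w ^ 2 / 6) := by
        gcongr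
        exact abs_gaussianLogDensity_sub_le m hv2 hw
    _ = (2 * |m| * w + m ^ 2) * Real.exp (1 - w ^ 2 / 6) +
          |(v : ℝ) - 1| * ((1 + w ^ 2) * Real.exp (1 - w ^ 2 / 6)) := by ring
    _ ≤ (2 * |m| * w + m ^ 2) * 3 + |(v : ℝ) - 1| * 18 := by
        gcongr
        exact one_add_sq_mul_exp_le w
    _ = 3 * (2 * |m| * w + (m ^ 2 + 6 * |(v : ℝ) - 1|)) := by ring

theorem abs_gaussianHalfLaplace_sub_le {m : ℝ} {v : NNReal} (hm : |m| ≤ 1 / 2)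
    (hv : |(v : ℝ) - 1| ≤ 1 / 2) {x : ℝ} (hx : 0 < x) :
    |gaussianHalfLaplace m v x - gaussianHalfLaplace 0 1 x| ≤
      3 / x * (2 * |m| / x + (m ^ 2 + 6 * |(v : ℝ) - 1|)) := by
  set q := m ^ 2 + 6 * |(v : ℝ) - 1|
  have hdom : IntegrableOn (fun w => 3 * (2 * |m| * (w * Real.exp (-(x * w))) +
      q * Real.exp (-(x * w)))) (Set.Ioi 0) :=
    (((integrableOn_mul_exp_neg_mul hx).const_mul _).add
      ((integrableOn_exp_neg_mul hx).const_mul _)).const_mul _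
  rw [gaussianHalfLaplace, gaussianHalfLaplace, ← integral_sub
    (integrableOn_exp_mul_gaussianPDFReal m v hx.le)
    (integrableOn_exp_mul_gaussianPDFReal 0 1 hx.le), ← Real.norm_eq_abs]
  refine (norm_integral_le_of_norm_le hdom ?_).trans_eq ?_
  · filter_upwards [ae_restrict_mem measurableSet_Ioi] with w hw
    rw [← mul_sub, norm_mul, Real.norm_of_nonneg (Real.exp_pos _).le, Real.norm_eq_abs]
    calc Real.exp (-(x * w)) * |gaussianPDFReal m v w - gaussianPDFReal 0 1 w|
        ≤ Real.exp (-(x * w)) * (3 * (2 * |m| * w + q)) := by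
          gcongr
          exact abs_gaussianPDFReal_sub_le hm hv (le_of_lt hw)
      _ = 3 * (2 * |m| * (w * Real.exp (-(x * w))) + q * Real.exp (-(x * w))) := by ring
  · rw [integral_const_mul, integral_add ((integrableOn_mul_exp_neg_mul hx).const_mul _)
      ((integrableOn_exp_neg_mul hx).const_mul _), integral_const_mul, integral_const_mul,
      setIntegral_mul_exp_neg_mul hx, setIntegral_exp_neg_mul hx]
    field_simp

/-! ### Analytic cumulant generating functions -/

theorem hasDerivAt_iteratedDeriv_of_analyticAt {𝕜 F : Type*} [NontriviallyNormedField 𝕜]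
    [NormedAddCommGroup F] [NormedSpace 𝕜 F] [CompleteSpace F] {f : 𝕜 → F} {z : 𝕜}
    (hf : AnalyticAt 𝕜 f z) (k : ℕ) :
    HasDerivAt (iteratedDeriv k f) (iteratedDeriv (k + 1) f z) z := by
  rw [iteratedDeriv_succ]
  have hk := hf.iterated_deriv k
  rw [← iteratedDeriv_eq_iterate] at hk
  exact hk.differentiableAt.hasDerivAt

theorem hasDerivAt_taylorPolynomial {𝕜 F : Type*} [RCLike 𝕜] [NormedAddCommGroup F]
    [NormedSpace 𝕜 F] (c : ℕ → F) (a : 𝕜) (n : ℕ) (w : 𝕜) :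
    HasDerivAt (fun w => ∑ k ∈ Finset.range (n + 1), ((k.factorial : 𝕜)⁻¹ * (w - a) ^ k) • c k)
      (∑ k ∈ Finset.range n, ((k.factorial : 𝕜)⁻¹ * (w - a) ^ k) • c (k + 1)) w := by
  simp only [Finset.sum_range_succ', pow_zero, mul_one]
  refine HasDerivAt.add_const _ (HasDerivAt.fun_sum fun k _ => HasDerivAt.smul_const ?_ _)
  convert! (((hasDerivAt_id w).sub_const a).pow (k + 1)).const_mul
    (((k + 1).factorial : 𝕜)⁻¹) using 1
  have hk : (k.factorial : 𝕜) ≠ 0 := Nat.cast_ne_zero.2 k.factorial_ne_zero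
  have hk1 : ((k : 𝕜) + 1) ≠ 0 := Nat.cast_add_one_ne_zero k
  simp only [Nat.factorial_succ, Nat.cast_mul, Nat.cast_succ, add_tsub_cancel_right, id_eq]
  field_simp

theorem norm_sub_sum_iteratedDeriv_le {𝕜 F : Type*} [RCLike 𝕜] [NormedAddCommGroup F]
    [NormedSpace 𝕜 F] [CompleteSpace F] {s : Set 𝕜} (hs : Convex ℝ s) {C : ℝ} {n : ℕ} {f : 𝕜 → F}
    (hf : AnalyticOnNhd 𝕜 f s) (hC : ∀ w ∈ s, ‖iteratedDeriv n f w‖ ≤ C) {a z : 𝕜} (ha : a ∈ s)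
    (hz : z ∈ s) :
    ‖f z - ∑ k ∈ Finset.range n, ((k.factorial : 𝕜)⁻¹ * (z - a) ^ k) • iteratedDeriv k f a‖ ≤
      C * ‖z - a‖ ^ n := by
  induction n generalizing f z with
  | zero => simpa using hC z hz
  | succ n ih =>
    have hseg : segment ℝ a z ⊆ s := hs.segment_subset ha hz
    have hC0 : 0 ≤ C := (norm_nonneg _).trans (hC a ha)
    have hmv := (convex_segment a z).norm_image_sub_le_of_norm_hasDerivWithin_le
      (C := C * ‖z - a‖ ^ n)
      (fun w hw => ((hf w (hseg hw)).differentiableAt.hasDerivAt.sub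
        (hasDerivAt_taylorPolynomial (fun k => iteratedDeriv k f a) a n w)).hasDerivWithinAt)
      (fun w hw => ?_) (left_mem_segment ℝ a z) (right_mem_segment ℝ a z)
    · rw [pow_succ, ← mul_assoc]
      simpa [Finset.sum_range_succ'] using hmv
    · simp only [iteratedDeriv_succ']
      refine (ih hf.deriv (by simpa only [iteratedDeriv_succ'] using hC) (hseg hw)).trans ?_
      gcongr
      exact norm_sub_le_of_mem_segment hw

section CauchyTaylor

variable {f : ℂ → ℂ} {R M : ℝ}

theorem norm_iteratedDeriv_le_of_norm_le (hR : 0 < R)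
    (hf : AnalyticOnNhd ℂ f (Metric.ball 0 R)) (hM : ∀ z, ‖z‖ < R → ‖f z‖ ≤ M) (k : ℕ) {z : ℂ}
    (hz : ‖z‖ < R / 2) : ‖iteratedDeriv k f z‖ ≤ k.factorial * M / (R / 4) ^ k := by
  have hsub : Metric.closedBall z (R / 4) ⊆ Metric.ball 0 R := by
    intro w hw
    rw [mem_closedBall_iff_norm] at hw
    rw [mem_ball_zero_iff]
    linarith [norm_le_norm_add_norm_sub' w z]
  exact Complex.norm_iteratedDeriv_le_of_forall_mem_sphere_norm_le k (by positivity)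
    ((hf.differentiableOn.mono hsub).diffContOnCl_ball subset_rfl) fun w hw =>
      hM w (mem_ball_zero_iff.1 (hsub (Metric.sphere_subset_closedBall hw)))

theorem norm_iteratedDeriv_sub_sum_iteratedDeriv_le (hR : 0 < R)
    (hf : AnalyticOnNhd ℂ f (Metric.ball 0 R)) (hM : ∀ z, ‖z‖ < R → ‖f z‖ ≤ M) (j n : ℕ) {a z : ℂ}
    (ha : ‖a‖ < R / 2) (hz : ‖z‖ < R / 2) :
    ‖iteratedDeriv j f z -
        ∑ k ∈ Finset.range n, (k.factorial : ℂ)⁻¹ * (z - a) ^ k * iteratedDeriv (j + k) f a‖ ≤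
      (j + n).factorial * M / (R / 4) ^ (j + n) * ‖z - a‖ ^ n := by
  have hiter : ∀ k, iteratedDeriv k (iteratedDeriv j f) = iteratedDeriv (j + k) f := fun k => by
    simp only [iteratedDeriv_eq_iterate, ← Function.iterate_add_apply, add_comm]
  have hball : Metric.ball (0 : ℂ) (R / 2) ⊆ Metric.ball 0 R :=
    Metric.ball_subset_ball (by linarith)
  have hfj : AnalyticOnNhd ℂ (iteratedDeriv j f) (Metric.ball 0 (R / 2)) := by
    rw [iteratedDeriv_eq_iterate]
    exact (hf.mono hball).iterated_deriv j
  have htaylor := norm_sub_sum_iteratedDeriv_le (n := n) (convex_ball (0 : ℂ) (R / 2)) hfj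
    (fun w hw => by
      rw [hiter]
      exact norm_iteratedDeriv_le_of_norm_le hR hf hM (j + n) (mem_ball_zero_iff.1 hw))
    (mem_ball_zero_iff.2 ha) (mem_ball_zero_iff.2 hz)
  simpa only [hiter, smul_eq_mul] using htaylor

end CauchyTaylor

theorem ofReal_mem_ball_zero {t R : ℝ} (ht : |t| < R) : (t : ℂ) ∈ Metric.ball (0 : ℂ) R := by
  simpa using ht

theorem mem_interior_integrableExpSet_of_abs_lt {Ω : Type*} [MeasurableSpace Ω] {X : Ω → ℝ}
    {P : Measure Ω} {H : ℝ} (hX : ∀ t : ℝ, |t| < H → Integrable (fun ω => Real.exp (t * X ω)) P)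
    {t : ℝ} (ht : |t| < H) : t ∈ interior (integrableExpSet X P) :=
  mem_interior.2 ⟨Set.Ioo (-H) H, fun s hs => hX s (abs_lt.2 hs), isOpen_Ioo, abs_lt.1 ht⟩

namespace IsAnalyticCGF

variable {Ω : Type*} [MeasurableSpace Ω] {X : Ω → ℝ} {P : Measure Ω} {H : ℝ} {L : ℂ → ℂ}

theorem mem_interior_integrableExpSet (hL : IsAnalyticCGF X P H L) {t : ℝ} (ht : |t| < H) :
    t ∈ interior (integrableExpSet X P) :=
  mem_interior_integrableExpSet_of_abs_lt hL.integrable_exp ht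

theorem aemeasurable (hL : IsAnalyticCGF X P H L) (hH : 0 < H) : AEMeasurable X P :=
  aemeasurable_of_mem_interior_integrableExpSet
    (hL.mem_interior_integrableExpSet (t := 0) (by simpa using hH))

theorem exp_sub_cgf_eq_one [NeZero P] (hL : IsAnalyticCGF X P H L) {t : ℝ} (ht : |t| < H) :
    Complex.exp (L t - cgf X P t) = 1 := by
  rw [Complex.exp_sub, hL.exp_eq t (ofReal_mem_ball_zero ht), complexMGF_ofReal,
    ← Complex.ofReal_exp, exp_cgf (hL.integrable_exp t ht), div_self]
  exact_mod_cast (mgf_pos' NeZero.out (hL.integrable_exp t ht)).ne'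

theorem ofReal_eq_cgf [IsProbabilityMeasure P] (hL : IsAnalyticCGF X P H L) {t : ℝ}
    (ht : |t| < H) : L t = cgf X P t := by
  have hder : ∀ s ∈ Set.Ioo (-H) H, HasDerivAt (fun s : ℝ => L s - cgf X P s) 0 s := by
    intro s hs
    have hdiff := ((hL.analytic s (ofReal_mem_ball_zero
      (abs_lt.2 hs))).differentiableAt.hasDerivAt.comp_ofReal).sub (analyticAt_cgf
        (hL.mem_interior_integrableExpSet (abs_lt.2 hs))).differentiableAt.hasDerivAt.ofReal_comp
    have hone := (hasDerivAt_const s (1 : ℂ)).congr_of_eventuallyEq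
      (Filter.mem_of_superset (isOpen_Ioo.mem_nhds hs) fun u hu =>
        hL.exp_sub_cgf_eq_one (abs_lt.2 hu))
    rwa [(mul_eq_zero.1 (hdiff.cexp.unique hone)).resolve_left (Complex.exp_ne_zero _)] at hdiff
  have hzero : (0 : ℝ) ∈ Set.Ioo (-H) H := by
    have hH := (abs_nonneg t).trans_lt ht
    exact ⟨neg_lt_zero.2 hH, hH⟩
  have hconst := (convex_Ioo (-H) H).norm_image_sub_le_of_norm_hasDerivWithin_le (C := 0)
    (fun s hs => (hder s hs).hasDerivWithinAt) (by simp) hzero (abs_lt.1 ht)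
  exact sub_eq_zero.1 (by simpa [hL.map_zero] using hconst)

theorem iteratedDeriv_ofReal [IsProbabilityMeasure P] (hL : IsAnalyticCGF X P H L) (k : ℕ) {t : ℝ}
    (ht : |t| < H) : iteratedDeriv k L t = iteratedDeriv k (cgf X P) t := by
  induction k generalizing t with
  | zero => simpa using hL.ofReal_eq_cgf ht
  | succ k ih =>
    have hcomplex := (hasDerivAt_iteratedDeriv_of_analyticAt
      (hL.analytic t (ofReal_mem_ball_zero ht)) k).comp_ofReal
    have hreal := (hasDerivAt_iteratedDeriv_of_analyticAt
      (analyticAt_cgf (hL.mem_interior_integrableExpSet ht)) k).ofReal_comp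
    refine hcomplex.unique (hreal.congr_of_eventuallyEq ?_)
    filter_upwards [isOpen_Ioo.mem_nhds (abs_lt.1 ht)] with s hs
    exact ih (abs_lt.2 hs)

theorem iteratedDeriv_zero_eq_cumulant [IsProbabilityMeasure P] (hL : IsAnalyticCGF X P H L)
    (hH : 0 < H) (k : ℕ) : iteratedDeriv k L 0 = cumulant k X P := by
  rw [cumulant, ← hL.iteratedDeriv_ofReal k (by simpa using hH), Complex.ofReal_zero]

theorem abs_iteratedDeriv_cgf_sub_sum_cumulant_le [IsProbabilityMeasure P]
    (hL : IsAnalyticCGF X P H L) (hH : 0 < H) {M : ℝ} (hM : ∀ z, ‖z‖ < H → ‖L z‖ ≤ M) (j n : ℕ)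
    {x : ℝ} (hx : |x| < H / 2) :
    |iteratedDeriv j (cgf X P) x -
        ∑ k ∈ Finset.range n, (k.factorial : ℝ)⁻¹ * x ^ k * cumulant (j + k) X P| ≤
      (j + n).factorial * M / (H / 4) ^ (j + n) * |x| ^ n := by
  have htaylor := norm_iteratedDeriv_sub_sum_iteratedDeriv_le hH hL.analytic hM j n (a := 0)
    (z := x) (by simpa using hH) (by simpa using hx)
  simp only [sub_zero, hL.iteratedDeriv_ofReal j (hx.trans (half_lt_self hH)),
    hL.iteratedDeriv_zero_eq_cumulant hH, Complex.norm_real, Real.norm_eq_abs] at htaylor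
  rw [← Real.norm_eq_abs, ← Complex.norm_real]
  push_cast
  exact htaylor

end IsAnalyticCGF

/-- The remainder of the third order Taylor expansion at `0` of the cumulant generating function of
a variable with mean zero and variance one. -/
noncomputable def cgfRemainder {Ω : Type*} [MeasurableSpace Ω] (Z : Ω → ℝ) (P : Measure Ω)
    (x : ℝ) : ℝ :=
  cgf Z P x - x ^ 2 / 2 - cumulant 3 Z P * x ^ 3 / 6

/-- `Z` has mean zero and variance one, expressed through its first two cumulants, and its cumulant
generating function extends to an analytic `L` with `|L| ≤ A D²` in the disc of radius `D`. For the
normalized sum in the main theorem, `D = H_n √B_n` is the scale in which errors are measured and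
`A` bounds `C_n / D²`. -/
structure IsStandardizedCGF {Ω : Type*} [MeasurableSpace Ω] (Z : Ω → ℝ) (P : Measure Ω)
    (D A : ℝ) (L : ℂ → ℂ) : Prop extends IsAnalyticCGF Z P D L where
  radius_pos : 0 < D
  norm_le : ∀ z, ‖z‖ < D → ‖L z‖ ≤ A * D ^ 2
  cumulant_one : cumulant 1 Z P = 0
  cumulant_two : cumulant 2 Z P = 1

namespace IsStandardizedCGF

variable {Ω : Type*} [MeasurableSpace Ω] {Z : Ω → ℝ} {P : Measure Ω} [IsProbabilityMeasure P]
  {D A : ℝ} {L : ℂ → ℂ}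

-- On a disc of radius `D / 4` Cauchy's estimate of the `k`th derivative costs a factor
-- `k! * 4 ^ k`, whence the constants `32 = 2! * 4 ^ 2`, `384 = 3! * 4 ^ 3` and `6144 = 4! * 4 ^ 4`.
theorem one_le_mul (hL : IsStandardizedCGF Z P D A L) : 1 ≤ 32 * A := by
  have hD := hL.radius_pos
  have hcauchy := norm_iteratedDeriv_le_of_norm_le hD hL.analytic hL.norm_le 2 (z := 0)
    (by simpa using hD)
  rw [hL.iteratedDeriv_zero_eq_cumulant hD, hL.cumulant_two, Complex.ofReal_one, norm_one,
    Nat.factorial_two] at hcauchy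
  exact hcauchy.trans_eq (by field_simp; ring)

theorem abs_cumulant_three_le (hL : IsStandardizedCGF Z P D A L) :
    |cumulant 3 Z P| ≤ 384 * A / D := by
  have hD := hL.radius_pos
  have hcauchy := norm_iteratedDeriv_le_of_norm_le hD hL.analytic hL.norm_le 3 (z := 0)
    (by simpa using hD)
  rw [hL.iteratedDeriv_zero_eq_cumulant hD, Complex.norm_real] at hcauchy
  refine hcauchy.trans_eq ?_
  simp only [Nat.factorial]
  field_simp
  ring

theorem abs_iteratedDeriv_two_cgf_sub_one_le (hL : IsStandardizedCGF Z P D A L) {x : ℝ}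
    (hx : |x| < D / 2) : |iteratedDeriv 2 (cgf Z P) x - 1| ≤ 384 * A / D * |x| := by
  have hD := hL.radius_pos
  calc |iteratedDeriv 2 (cgf Z P) x - 1| ≤ 6 * (A * D ^ 2) / (D / 4) ^ 3 * |x| := by
        simpa [hL.cumulant_two, Nat.factorial] using
          hL.abs_iteratedDeriv_cgf_sub_sum_cumulant_le hD hL.norm_le 2 1 hx
    _ = 384 * A / D * |x| := by field_simp; ring

theorem abs_deriv_cgf_sub_le (hL : IsStandardizedCGF Z P D A L) {x : ℝ} (hx : |x| < D / 2) :
    |deriv (cgf Z P) x - x| ≤ 384 * A / D * x ^ 2 := by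
  have hD := hL.radius_pos
  calc |deriv (cgf Z P) x - x| ≤ 6 * (A * D ^ 2) / (D / 4) ^ 3 * x ^ 2 := by
        simpa [Finset.sum_range_succ, hL.cumulant_one, hL.cumulant_two, Nat.factorial] using
          hL.abs_iteratedDeriv_cgf_sub_sum_cumulant_le hD hL.norm_le 1 2 hx
    _ = 384 * A / D * x ^ 2 := by field_simp; ring

theorem abs_cgfRemainder_le (hL : IsStandardizedCGF Z P D A L) {x : ℝ} (hx : |x| < D / 2) :
    |cgfRemainder Z P x| ≤ 6144 * A / D ^ 2 * x ^ 4 := by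
  have hD := hL.radius_pos
  have hzero : cumulant 0 Z P = 0 := by simp [cumulant]
  calc |cgfRemainder Z P x|
      = |cgf Z P x - (2⁻¹ * x ^ 2 + 6⁻¹ * x ^ 3 * cumulant 3 Z P)| := by
        rw [cgfRemainder]; congr 1; ring
    _ ≤ 24 * (A * D ^ 2) / (D / 4) ^ 4 * x ^ 4 := by
        simpa [Finset.sum_range_succ, hzero, hL.cumulant_one, hL.cumulant_two, Nat.factorial,
          Even.pow_abs (show Even 4 by decide)] using
          hL.abs_iteratedDeriv_cgf_sub_sum_cumulant_le hD hL.norm_le 0 4 hx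
    _ = 6144 * A / D ^ 2 * x ^ 4 := by field_simp; ring

end IsStandardizedCGF

/-! ### Exponential tilting -/

section Tilt

variable {Ω : Type*} [MeasurableSpace Ω] {P : Measure Ω} {Z : Ω → ℝ}

/-- The law of `Z` under the exponential change of measure with parameter `x`. -/
noncomputable def tiltedLaw (P : Measure Ω) (Z : Ω → ℝ) (x : ℝ) : Measure ℝ :=
  (P.tilted fun ω => x * Z ω).map Z

theorem isProbabilityMeasure_tiltedLaw [NeZero P] (hZ : AEMeasurable Z P) {x : ℝ}
    (hx : Integrable (fun ω => Real.exp (x * Z ω)) P) : IsProbabilityMeasure (tiltedLaw P Z x) := by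
  have := isProbabilityMeasure_tilted hx
  exact Measure.isProbabilityMeasure_map (hZ.mono_ac (tilted_absolutelyContinuous P _))

theorem integrable_id_tiltedLaw {x : ℝ} (hx : x ∈ interior (integrableExpSet Z P)) :
    Integrable id (tiltedLaw P Z x) := by
  have hZ := aemeasurable_of_mem_interior_integrableExpSet hx
  rw [tiltedLaw, integrable_map_measure (by fun_prop)
    (hZ.mono_ac (tilted_absolutelyContinuous P _))]
  exact memLp_one_iff_integrable.1 (by simpa using memLp_tilted_mul hx 1)

theorem charFun_tiltedLaw (hZ : AEMeasurable Z P) (x t : ℝ) :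
    charFun (tiltedLaw P Z x) t = complexMGF Z P (x + t * Complex.I) / mgf Z P x := by
  rw [tiltedLaw, ← complexMGF_mul_I (hZ.mono_ac (tilted_absolutelyContinuous P _)), complexMGF,
    integral_tilted_mul_eq_mgf, complexMGF, ← integral_div]
  congr with ω
  rw [add_mul, Complex.exp_add, Complex.real_smul]
  push_cast
  ring

theorem measureReal_ge_eq_integral_expTail [NeZero P] (hZ : AEMeasurable Z P) {x : ℝ}
    (hx : Integrable (fun ω => Real.exp (x * Z ω)) P) :
    P.real {ω | x ≤ Z ω} =
      Real.exp (cgf Z P x - x ^ 2) * ∫ y, expTail x x y ∂(tiltedLaw P Z x) := by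
  have hdensity : ∀ ω, Real.exp (cgf Z P x - x ^ 2) *
      (Real.exp (x * Z ω) / mgf Z P x) • expTail x x (Z ω) =
        {ω | x ≤ Z ω}.indicator (fun _ => (1 : ℝ)) ω := by
    intro ω
    simp only [expTail, Set.indicator, Set.mem_Ici, Set.mem_ofPred_eq]
    split_ifs
    · rw [Real.exp_sub, exp_cgf hx, smul_eq_mul]
      have hmgf := (mgf_pos' NeZero.out hx).ne'
      field_simp
      rw [← Real.exp_add]
      ring_nf
    · simp
  rw [tiltedLaw, integral_map (hZ.mono_ac (tilted_absolutelyContinuous P _))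
    (measurable_expTail x x).aestronglyMeasurable, integral_tilted_mul_eq_mgf,
    ← integral_const_mul]
  simp only [hdensity]
  rw [integral_indicator₀ (nullMeasurableSet_le aemeasurable_const hZ)]
  simp

theorem IsAnalyticCGF.charFun_tiltedLaw {H : ℝ} {L : ℂ → ℂ} (hL : IsAnalyticCGF Z P H L)
    {x t : ℝ} (hx : |x| < H) (hxt : ‖(x : ℂ) + t * Complex.I‖ < H) :
    charFun (tiltedLaw P Z x) t = Complex.exp (L (x + t * Complex.I) - L x) := by
  rw [_root_.charFun_tiltedLaw (hL.aemeasurable ((abs_nonneg x).trans_lt hx)), ← complexMGF_ofReal,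
    ← hL.exp_eq _ (ofReal_mem_ball_zero hx), ← hL.exp_eq _ (mem_ball_zero_iff.2 hxt),
    Complex.exp_sub]

end Tilt

theorem norm_charFun_gaussianReal (m : ℝ) (v : NNReal) (t : ℝ) :
    ‖charFun (gaussianReal m v) t‖ = Real.exp (-(v * t ^ 2 / 2)) := by
  rw [charFun_gaussianReal, Complex.norm_exp,
    show (t : ℂ) * m * Complex.I - v * t ^ 2 / 2 =
      ((-(v * t ^ 2 / 2) : ℝ) : ℂ) + ((t * m : ℝ) : ℂ) * Complex.I by push_cast; ring,
    Complex.add_re, Complex.ofReal_re, Complex.re_ofReal_mul, Complex.I_re, mul_zero, add_zero]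

theorem integrableOn_sq_mul_exp_neg_sq {b : ℝ} (hb : 0 < b) :
    IntegrableOn (fun t : ℝ => t ^ 2 * Real.exp (-(b * t ^ 2))) (Set.Ioi 0) := by
  simpa only [Real.rpow_ofNat, neg_mul] using
    (integrable_rpow_mul_exp_neg_mul_sq hb (s := 2) (by norm_num)).integrableOn

theorem norm_mul_exp_sub_self_le (w R : ℂ) :
    ‖w * Complex.exp R - w‖ ≤ ‖w‖ * (‖R‖ * Real.exp ‖R‖) := by
  rw [← mul_sub_one, norm_mul]
  gcongr
  simpa using Complex.norm_exp_sub_sum_le_norm_mul_exp R 1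

namespace IsStandardizedCGF

variable {Ω : Type*} [MeasurableSpace Ω] {Z : Ω → ℝ} {P : Measure Ω} [IsProbabilityMeasure P]
  {D A : ℝ} {L : ℂ → ℂ} {x : ℝ}

theorem lt_radius_div (hL : IsStandardizedCGF Z P D A L) (hx0 : 0 ≤ x) (hx : 384 * A * x ≤ D / 2) :
    x < D / 4 := by
  nlinarith [hL.one_le_mul, hL.radius_pos]

theorem abs_iteratedDeriv_two_cgf_sub_one_le_half (hL : IsStandardizedCGF Z P D A L) (hx0 : 0 ≤ x)
    (hx : 384 * A * x ≤ D / 2) : |iteratedDeriv 2 (cgf Z P) x - 1| ≤ 1 / 2 := by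
  have hD := hL.radius_pos
  have hxD := hL.lt_radius_div hx0 hx
  refine (hL.abs_iteratedDeriv_two_cgf_sub_one_le (by rw [abs_of_nonneg hx0]; linarith)).trans ?_
  rw [abs_of_nonneg hx0, div_mul_eq_mul_div, div_le_iff₀ hD]
  linarith

theorem half_le_iteratedDeriv_two_cgf (hL : IsStandardizedCGF Z P D A L) (hx0 : 0 ≤ x)
    (hx : 384 * A * x ≤ D / 2) : 1 / 2 ≤ iteratedDeriv 2 (cgf Z P) x := by
  linarith [(abs_le.1 (hL.abs_iteratedDeriv_two_cgf_sub_one_le_half hx0 hx)).1]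

theorem exists_charFun_tiltedLaw_eq_mul_exp (hL : IsStandardizedCGF Z P D A L) (hx0 : 0 ≤ x)
    (hx : 384 * A * x ≤ D / 2) {t : ℝ} (ht0 : 0 ≤ t) (ht : t < D / 4) :
    ∃ R : ℂ, ‖R‖ ≤ 384 * A / D * t ^ 3 ∧ charFun (tiltedLaw P Z x) t =
      charFun (gaussianReal (deriv (cgf Z P) x) (iteratedDeriv 2 (cgf Z P) x).toNNReal) t *
        Complex.exp R := by
  have hD := hL.radius_pos
  have hxD := hL.lt_radius_div hx0 hx
  have hxH : |x| < D := by rw [abs_of_nonneg hx0]; linarith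
  have hxn : ‖(x : ℂ)‖ = x := by rw [Complex.norm_real, Real.norm_of_nonneg hx0]
  have htn : ‖(t : ℂ) * Complex.I‖ = t := by
    rw [norm_mul, Complex.norm_I, mul_one, Complex.norm_real, Real.norm_of_nonneg ht0]
  have hzn : ‖(x : ℂ) + t * Complex.I‖ < D / 2 := by
    refine (norm_add_le _ _).trans_lt ?_
    rw [hxn, htn]
    linarith
  have htaylor := norm_iteratedDeriv_sub_sum_iteratedDeriv_le hD hL.analytic hL.norm_le 0 3
    (a := x) (by linarith) hzn
  rw [add_sub_cancel_left, htn] at htaylor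
  refine ⟨_, htaylor.trans_eq ?_, ?_⟩
  · simp only [Nat.factorial]
    field_simp
    ring
  · rw [hL.charFun_tiltedLaw hxH (by linarith), charFun_gaussianReal,
      ← Complex.exp_add, Real.coe_toNNReal _ (by
        linarith [hL.half_le_iteratedDeriv_two_cgf hx0 hx])]
    simp only [Finset.sum_range_succ, Finset.sum_range_zero, zero_add, iteratedDeriv_zero,
      hL.iteratedDeriv_ofReal _ hxH, hL.ofReal_eq_cgf hxH, mul_pow, Complex.I_sq, iteratedDeriv_one,
      Nat.factorial, pow_zero, pow_one]
    congr 1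
    push_cast
    ring

theorem norm_charFun_tiltedLaw_sub_le (hL : IsStandardizedCGF Z P D A L) (hx0 : 0 ≤ x)
    (hx : 384 * A * x ≤ D / 2) {t : ℝ} (ht0 : 0 ≤ t) (ht : 384 * A * t ≤ D / 8) :
    ‖charFun (tiltedLaw P Z x) t - charFun (gaussianReal (deriv (cgf Z P) x)
        (iteratedDeriv 2 (cgf Z P) x).toNNReal) t‖ ≤
      384 * A / D * (t ^ 2 * Real.exp (-(1 / 8 * t ^ 2))) * t := by
  have hD := hL.radius_pos
  obtain ⟨R, hR, hchar⟩ :=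
    hL.exists_charFun_tiltedLaw_eq_mul_exp hx0 hx ht0 (hL.lt_radius_div ht0 (by linarith))
  have hR8 : ‖R‖ ≤ 1 / 8 * t ^ 2 := by
    refine hR.trans ?_
    rw [div_mul_eq_mul_div, div_le_iff₀ hD]
    nlinarith [mul_le_mul_of_nonneg_left ht (sq_nonneg t)]
  set σ := iteratedDeriv 2 (cgf Z P) x
  have hσ : 1 / 2 ≤ σ := hL.half_le_iteratedDeriv_two_cgf hx0 hx
  have hgauss : ‖charFun (gaussianReal (deriv (cgf Z P) x) σ.toNNReal) t‖ ≤
      Real.exp (-(1 / 4 * t ^ 2)) := by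
    rw [norm_charFun_gaussianReal, Real.coe_toNNReal _ (by linarith)]
    exact Real.exp_le_exp.2 (by nlinarith [sq_nonneg t])
  have hA : 0 < A := by linarith [hL.one_le_mul]
  rw [hchar]
  refine (norm_mul_exp_sub_self_le _ _).trans ?_
  calc _ ≤ Real.exp (-(1 / 4 * t ^ 2)) * (384 * A / D * t ^ 3 * Real.exp (1 / 8 * t ^ 2)) := by
        gcongr
    _ = 384 * A / D * (t ^ 2 * (Real.exp (-(1 / 4 * t ^ 2)) * Real.exp (1 / 8 * t ^ 2))) * t := by
        ring
    _ = 384 * A / D * (t ^ 2 * Real.exp (-(1 / 8 * t ^ 2))) * t := by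
        rw [← Real.exp_add]
        ring_nf

end IsStandardizedCGF

theorem exists_abs_tiltedLaw_Iio_sub_le.{u} : ∃ C : ℝ, 0 < C ∧ ∀ {Ω : Type u} [MeasurableSpace Ω]
    {Z : Ω → ℝ} {P : Measure Ω} [IsProbabilityMeasure P] {D A x : ℝ} {L : ℂ → ℂ},
    IsStandardizedCGF Z P D A L → 0 ≤ x → 384 * A * x ≤ D / 2 → ∀ y,
      |(tiltedLaw P Z x).real (Set.Iio y) - (gaussianReal (deriv (cgf Z P) x)
        (iteratedDeriv 2 (cgf Z P) x).toNNReal).real (Set.Iio y)| ≤ C * A / D := by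
  obtain ⟨C, hC, hsmooth⟩ := exists_esseen_smoothing
  set I := ∫ t in Set.Ioi (0 : ℝ), t ^ 2 * Real.exp (-(1 / 8 * t ^ 2))
  have hI0 : 0 ≤ I := setIntegral_nonneg measurableSet_Ioi fun t _ => by positivity
  refine ⟨C * (384 * I + 3072), by positivity, fun {Ω _ Z P _ D A x L} hL hx0 hx y => ?_⟩
  have hD := hL.radius_pos
  have hA : 0 < A := by linarith [hL.one_le_mul]
  have hxD : |x| < D := by rw [abs_of_nonneg hx0]; linarith [hL.lt_radius_div hx0 hx]
  have := isProbabilityMeasure_tiltedLaw (hL.aemeasurable hD) (hL.integrable_exp x hxD)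
  set T := D / (3072 * A)
  have hT : 0 < T := by positivity
  have hintegral : ∫ t in (0 : ℝ)..T, ‖charFun (tiltedLaw P Z x) t - charFun (gaussianReal
      (deriv (cgf Z P) x) (iteratedDeriv 2 (cgf Z P) x).toNNReal) t‖ / t ≤ 384 * A / D * I := by
    have hdom : IntegrableOn (fun t => 384 * A / D * (t ^ 2 * Real.exp (-(1 / 8 * t ^ 2))))
        (Set.Ioi 0) := (integrableOn_sq_mul_exp_neg_sq (by norm_num)).const_mul _
    rw [intervalIntegral.integral_of_le hT.le, ← integral_const_mul]
    refine (integral_mono_of_nonneg ?_ (hdom.mono_set Set.Ioc_subset_Ioi_self) ?_).trans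
      (setIntegral_mono_set hdom (ae_of_all _ fun t => by positivity)
        Set.Ioc_subset_Ioi_self.eventuallyLE)
    all_goals filter_upwards [ae_restrict_mem measurableSet_Ioc] with t ht
    · exact div_nonneg (norm_nonneg _) ht.1.le
    · have htT : t * (3072 * A) ≤ D := (le_div_iff₀ (by positivity)).1 ht.2
      exact div_le_of_le_mul₀ ht.1.le (by positivity)
        (hL.norm_charFun_tiltedLaw_sub_le hx0 hx ht.1.le (by linarith))
  have hvar : 1 / 2 ≤ (iteratedDeriv 2 (cgf Z P) x).toNNReal := by
    rw [Real.le_toNNReal_iff_coe_le (by linarith [hL.half_le_iteratedDeriv_two_cgf hx0 hx])]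
    simpa using hL.half_le_iteratedDeriv_two_cgf hx0 hx
  refine (hsmooth _ _ (integrable_id_tiltedLaw (hL.mem_interior_integrableExpSet hxD))
    (memLp_one_iff_integrable.1 (by simpa using memLp_id_gaussianReal 1)) 1
    (by simpa using gaussianReal_le_volume _ hvar) T hT y).trans ?_
  calc C * (_ + ((1 : NNReal) : ℝ) / T) ≤ C * (384 * A / D * I + 1 / T) := by
        gcongr
        exact NNReal.coe_one.le
    _ = C * (384 * I + 3072) * A / D := by
        simp only [T]
        field_simp

theorem mul_sq_le_of_cube_le {a x K D : ℝ} (ha : 0 ≤ a) (hx : 0 ≤ x) (hD : K ^ 2 * a ^ 3 ≤ D)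
    (hxK : x ^ 3 ≤ K * D) : a * x ^ 2 ≤ D := by
  have hD0 : 0 ≤ D := le_trans (by positivity) hD
  refine le_of_pow_le_pow_left₀ three_ne_zero hD0 ?_
  calc (a * x ^ 2) ^ 3 = a ^ 3 * (x ^ 3) ^ 2 := by ring
    _ ≤ a ^ 3 * (K * D) ^ 2 := by gcongr
    _ = K ^ 2 * a ^ 3 * D ^ 2 := by ring
    _ ≤ D * D ^ 2 := by gcongr
    _ = D ^ 3 := by ring

theorem abs_exp_mul_sub_le {r y z : ℝ} (hr : |r| ≤ 1) (hz : 0 ≤ z) :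
    |Real.exp r * y - z| ≤ 3 * |y - z| + 2 * (z * |r|) := by
  have hexp : Real.exp r ≤ 3 :=
    (Real.exp_le_exp.2 ((le_abs_self r).trans hr)).trans Real.exp_one_lt_three.le
  calc |Real.exp r * y - z| = |Real.exp r * (y - z) + z * (Real.exp r - 1)| := by ring_nf
    _ ≤ |Real.exp r * (y - z)| + |z * (Real.exp r - 1)| := abs_add_le _ _
    _ = Real.exp r * |y - z| + z * |Real.exp r - 1| := by
        rw [abs_mul, abs_mul, Real.abs_exp, abs_of_nonneg hz]
    _ ≤ 3 * |y - z| + z * (2 * |r|) := by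
        gcongr
        exact Real.abs_exp_sub_one_le hr
    _ = 3 * |y - z| + 2 * (z * |r|) := by ring

theorem measureReal_ge_sub_eq_exp_mul {Ω : Type*} [MeasurableSpace Ω] {P : Measure Ω} [NeZero P]
    {Z : Ω → ℝ} (hZ : AEMeasurable Z P) {x : ℝ}
    (hx : Integrable (fun ω => Real.exp (x * Z ω)) P) :
    P.real {ω | x ≤ Z ω} - (1 - stdNormalDF x) * Real.exp (cumulant 3 Z P * x ^ 3 / 6) =
      Real.exp (-x ^ 2 / 2) * Real.exp (cumulant 3 Z P * x ^ 3 / 6) *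
        (Real.exp (cgfRemainder Z P x) * ∫ y, expTail x x y ∂(tiltedLaw P Z x) -
          gaussianHalfLaplace 0 1 x) := by
  rw [measureReal_ge_eq_integral_expTail hZ hx, one_sub_stdNormalDF,
    show cgf Z P x - x ^ 2 = -x ^ 2 / 2 + cumulant 3 Z P * x ^ 3 / 6 + cgfRemainder Z P x by
      rw [cgfRemainder]; ring,
    Real.exp_add, Real.exp_add]
  ring

namespace IsStandardizedCGF

variable {Ω : Type*} [MeasurableSpace Ω] {Z : Ω → ℝ} {P : Measure Ω} [IsProbabilityMeasure P]
  {D A K : ℝ} {L : ℂ → ℂ} {x : ℝ}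

theorem abs_cgfRemainder_le_one (hL : IsStandardizedCGF Z P D A L) (hx : |x| < D / 2)
    (hx2 : 1536 * A * x ^ 2 ≤ D) : |cgfRemainder Z P x| ≤ 1 := by
  have hA : 0 < A := by linarith [hL.one_le_mul]
  have hD := hL.radius_pos
  refine (hL.abs_cgfRemainder_le hx).trans ?_
  rw [div_mul_eq_mul_div, div_le_one (by positivity)]
  calc 6144 * A * x ^ 4 = 192 * 1 * (32 * A * x ^ 4) := by ring
    _ ≤ 192 * (384 * A) * (32 * A * x ^ 4) := by
        gcongr
        linarith [hL.one_le_mul]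
    _ = (1536 * A * x ^ 2) ^ 2 := by ring
    _ ≤ D ^ 2 := by gcongr

theorem cumulant_three_mul_le (hL : IsStandardizedCGF Z P D A L) (hx0 : 0 ≤ x)
    (hxK : x ^ 3 ≤ K * D) : cumulant 3 Z P * x ^ 3 / 6 ≤ 64 * A * K := by
  have hA : 0 < A := by linarith [hL.one_le_mul]
  have hD := hL.radius_pos
  calc cumulant 3 Z P * x ^ 3 / 6 ≤ 384 * A / D * (K * D) / 6 := by
        gcongr
        exact (le_abs_self _).trans hL.abs_cumulant_three_le
    _ = 64 * A * K := by field_simp; ring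

theorem gaussianHalfLaplace_mul_abs_cgfRemainder_le (hL : IsStandardizedCGF Z P D A L)
    (hx0 : 0 ≤ x) (hx : x < D / 2) (hxK : x ^ 3 ≤ K * D) :
    gaussianHalfLaplace 0 1 x * |cgfRemainder Z P x| ≤ 6144 * A * K / D := by
  have hA : 0 < A := by linarith [hL.one_le_mul]
  have hD := hL.radius_pos
  calc gaussianHalfLaplace 0 1 x * |cgfRemainder Z P x|
      ≤ gaussianHalfLaplace 0 1 x * (6144 * A / D ^ 2 * x ^ 4) := by
        gcongr
        · exact gaussianHalfLaplace_nonneg 0 1 x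
        · exact hL.abs_cgfRemainder_le (by rwa [abs_of_nonneg hx0])
    _ = x * gaussianHalfLaplace 0 1 x * (6144 * A * (x ^ 3 / D) / D) := by field_simp
    _ ≤ 1 * (6144 * A * K / D) := by
        gcongr
        · exact mul_gaussianHalfLaplace_le_one 0 (by norm_num) hx0
        · exact (div_le_iff₀ hD).2 hxK
    _ = 6144 * A * K / D := one_mul _

theorem abs_gaussianHalfLaplace_sub_le (hL : IsStandardizedCGF Z P D A L) (hx0 : 0 ≤ x)
    (hx : 384 * A * x ≤ D / 2) (hx2 : 1536 * A * x ^ 2 ≤ D) (hxK : x ^ 3 ≤ K * D) :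
    |gaussianHalfLaplace (deriv (cgf Z P) x - x) (iteratedDeriv 2 (cgf Z P) x).toNNReal x -
      gaussianHalfLaplace 0 1 x| ≤ 3 * (8 * (384 * A) + (384 * A) ^ 2 * K) / D := by
  have hD := hL.radius_pos
  have hxD : |x| < D / 2 := by rw [abs_of_nonneg hx0]; linarith [hL.lt_radius_div hx0 hx]
  have hmean := hL.abs_deriv_cgf_sub_le hxD
  have hvar := hL.abs_iteratedDeriv_two_cgf_sub_one_le hxD
  rw [abs_of_nonneg hx0] at hvar
  have hmean_half : |deriv (cgf Z P) x - x| ≤ 1 / 2 := by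
    refine hmean.trans ?_
    rw [div_mul_eq_mul_div, div_le_iff₀ hD]
    linarith
  have hcoe : ((iteratedDeriv 2 (cgf Z P) x).toNNReal : ℝ) = iteratedDeriv 2 (cgf Z P) x :=
    Real.coe_toNNReal _ (by linarith [hL.half_le_iteratedDeriv_two_cgf hx0 hx])
  have hA : 0 < A := by linarith [hL.one_le_mul]
  have hK : 0 ≤ K := nonneg_of_mul_nonneg_left ((pow_nonneg hx0 3).trans hxK) hD
  rcases hx0.eq_or_lt with rfl | hx_pos
  · have hvar_one : iteratedDeriv 2 (cgf Z P) 0 = 1 := hL.cumulant_two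
    have hmean_zero : deriv (cgf Z P) 0 = 0 := by simpa [cumulant] using hL.cumulant_one
    rw [hmean_zero, hvar_one, sub_zero, Real.toNNReal_one, sub_self, abs_zero]
    positivity
  · refine (_root_.abs_gaussianHalfLaplace_sub_le hmean_half
      (by rw [hcoe]; exact hL.abs_iteratedDeriv_two_cgf_sub_one_le_half hx0 hx) hx_pos).trans ?_
    rw [hcoe, ← sq_abs]
    calc _ ≤ 3 / x * (2 * (384 * A / D * x ^ 2) / x +
          ((384 * A / D * x ^ 2) ^ 2 + 6 * (384 * A / D * x))) := by gcongr
      _ = 3 * (8 * (384 * A) + (384 * A) ^ 2 * (x ^ 3 / D)) / D := by field_simp; ring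
      _ ≤ 3 * (8 * (384 * A) + (384 * A) ^ 2 * K) / D := by
          gcongr
          exact (div_le_iff₀ hD).2 hxK

end IsStandardizedCGF

theorem exists_abs_measureReal_ge_sub_le.{u} (A K : ℝ) : ∃ M D₀ : ℝ, ∀ {Ω : Type u}
    [MeasurableSpace Ω] {Z : Ω → ℝ} {P : Measure Ω} [IsProbabilityMeasure P] {D x : ℝ} {L : ℂ → ℂ},
    IsStandardizedCGF Z P D A L → D₀ ≤ D → 0 ≤ x → x ^ 3 ≤ K * D →
      |P.real {ω | x ≤ Z ω} - (1 - stdNormalDF x) * Real.exp (cumulant 3 Z P * x ^ 3 / 6)| ≤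
        M * (Real.exp (-x ^ 2 / 2) / D) := by
  obtain ⟨C, -, htilt⟩ := exists_abs_tiltedLaw_Iio_sub_le
  refine ⟨Real.exp (64 * A * K) * (3 * (2 * (C * A) + 3 * (8 * (384 * A) + (384 * A) ^ 2 * K)) +
    2 * (6144 * A * K)), K ^ 2 * (1536 * A) ^ 3 + 1536 * A,
    fun {Ω _ Z P _ D x L} hL hD₀ hx0 hxK => ?_⟩
  have hD := hL.radius_pos
  have hA : 0 < A := by linarith [hL.one_le_mul]
  have hDK : K ^ 2 * (1536 * A) ^ 3 ≤ D := by linarith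
  have hDA : 1536 * A ≤ D := le_trans (by linarith [show 0 ≤ K ^ 2 * (1536 * A) ^ 3 by positivity])
    hD₀
  have hx2 : 1536 * A * x ^ 2 ≤ D := mul_sq_le_of_cube_le (by positivity) hx0 hDK hxK
  have hx : 384 * A * x ≤ D / 2 := by nlinarith [mul_nonneg hA.le (sq_nonneg (x - 1))]
  have hxD := hL.lt_radius_div hx0 hx
  have habs : |x| < D / 2 := by rw [abs_of_nonneg hx0]; linarith
  have hZ := hL.aemeasurable hD
  have hexp := hL.integrable_exp x (by linarith)
  have := isProbabilityMeasure_tiltedLaw hZ hexp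
  have hvar : (iteratedDeriv 2 (cgf Z P) x).toNNReal ≠ 0 := by
    rw [Ne, Real.toNNReal_eq_zero, not_le]
    linarith [hL.half_le_iteratedDeriv_two_cgf hx0 hx]
  have hclt := abs_integral_expTail_sub_le _ _ (htilt hL hx0 hx) hx0 x
  rw [integral_expTail_gaussianReal _ _ _ hvar] at hclt
  have hlaplace := (abs_sub_le _ _ _).trans
    (add_le_add hclt (hL.abs_gaussianHalfLaplace_sub_le hx0 hx hx2 hxK))
  have hremainder := hL.gaussianHalfLaplace_mul_abs_cgfRemainder_le hx0 (by linarith) hxK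
  rw [measureReal_ge_sub_eq_exp_mul hZ hexp, abs_mul, abs_of_pos (by positivity)]
  calc _ ≤ Real.exp (-x ^ 2 / 2) * Real.exp (64 * A * K) *
        (3 * (2 * (C * A / D) + 3 * (8 * (384 * A) + (384 * A) ^ 2 * K) / D) +
          2 * (6144 * A * K / D)) := by
        gcongr
        · exact hL.cumulant_three_mul_le hx0 hxK
        · refine (abs_exp_mul_sub_le (hL.abs_cgfRemainder_le_one habs hx2)
            (gaussianHalfLaplace_nonneg 0 1 x)).trans ?_
          gcongr
    _ = _ := by ring

/-! ### Sums of independent variables -/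

theorem hasSum_iteratedDeriv_tsum {ι : Type*} (k : ℕ) {R : ℝ} (hR : 0 < R) {F : ι → ℂ → ℂ}
    {c : ι → ℝ} (hc : Summable c) (hF : ∀ j, AnalyticOnNhd ℂ (F j) (Metric.ball 0 R))
    (hFc : ∀ j z, ‖z‖ < R → ‖F j z‖ ≤ c j) :
    HasSum (fun j => iteratedDeriv k (F j) 0) (iteratedDeriv k (fun z => ∑' j, F j z) 0) := by
  induction k generalizing R F c with
  | zero =>
    simp only [iteratedDeriv_zero]
    exact (Summable.of_norm_bounded hc fun j => hFc j 0 (by simpa using hR)).hasSum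
  | succ k ih =>
    have hderiv := ih (half_pos hR) ((hc.mul_left (Nat.factorial 1 : ℝ)).div_const ((R / 4) ^ 1))
      (fun j => (hF j).deriv.mono (Metric.ball_subset_ball (half_le_self hR.le))) fun j z hz => by
        rw [← iteratedDeriv_one]
        exact norm_iteratedDeriv_le_of_norm_le hR (hF j) (hFc j) 1 hz
    have htsum : (fun z => ∑' j, deriv (F j) z) =ᶠ[𝓝 0] deriv fun z => ∑' j, F j z := by
      filter_upwards [Metric.ball_mem_nhds 0 hR] with z hz
      exact (Complex.hasSum_deriv_of_summable_norm hc (fun j => (hF j).differentiableOn)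
        Metric.isOpen_ball (fun j w hw => hFc j w (mem_ball_zero_iff.1 hw)) hz).tsum_eq
    simp only [iteratedDeriv_succ']
    rwa [htsum.iteratedDeriv_eq] at hderiv

theorem integrable_exp_mul_of_tendstoInMeasure {Ω κ : Type*} [MeasurableSpace Ω] {P : Measure Ω}
    {u : Filter κ} [u.NeBot] [u.IsCountablyGenerated] {Y : κ → Ω → ℝ} {S : Ω → ℝ}
    (hYS : TendstoInMeasure P Y u S) (hY : ∀ k, AEMeasurable (Y k) P) {t C : ℝ}
    (hint : ∀ k, Integrable (fun ω => Real.exp (t * Y k ω)) P) (hC : ∀ k, mgf (Y k) P t ≤ C) :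
    Integrable (fun ω => Real.exp (t * S ω)) P := by
  obtain ⟨ns, -, hae⟩ := hYS.exists_seq_tendsto_ae'
  have hS : AEMeasurable S P := hYS.aemeasurable hY
  have hnorm : eLpNorm (fun ω => Real.exp (t * S ω)) 1 P ≤ ENNReal.ofReal C := by
    refine Lp.eLpNorm_le_of_ae_tendsto (u := atTop) (f := fun k ω => Real.exp (t * Y (ns k) ω))
      (.of_forall fun k => ?_) (fun k => (hint _).aestronglyMeasurable) ?_
    · rw [eLpNorm_one_eq_lintegral_enorm, ← ofReal_integral_norm_eq_lintegral_enorm (hint _)]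
      simpa only [Real.norm_eq_abs, Real.abs_exp, mgf] using ENNReal.ofReal_le_ofReal (hC (ns k))
    · filter_upwards [hae] with ω hω
      exact (Real.continuous_exp.tendsto _).comp (hω.const_mul t)
  exact memLp_one_iff_integrable.1
    ⟨AEMeasurable.aestronglyMeasurable (by fun_prop), hnorm.trans_lt ENNReal.ofReal_lt_top⟩

theorem tendsto_charFun_of_tendstoInMeasure {Ω κ : Type*} [MeasurableSpace Ω] {P : Measure Ω}
    [IsProbabilityMeasure P] {u : Filter κ} [u.NeBot] [u.IsCountablyGenerated] {Y : κ → Ω → ℝ}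
    {S : Ω → ℝ} (hYS : TendstoInMeasure P Y u S) (hY : ∀ k, AEMeasurable (Y k) P) (t : ℝ) :
    Tendsto (fun k => charFun (P.map (Y k)) t) u (𝓝 (charFun (P.map S) t)) := by
  have hmap := (hYS.tendstoInDistribution hY).tendsto
  simp only [charFun_eq_integral_innerProbChar]
  exact (ProbabilityMeasure.tendsto_iff_forall_integral_rclike_tendsto ℂ).1 hmap
    (BoundedContinuousFunction.innerProbChar t)

theorem tendsto_ofReal_mul_I_nhdsNE_zero :
    Tendsto (fun t : ℝ => (t : ℂ) * Complex.I) (𝓝[≠] 0) (𝓝[≠] 0) := by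
  refine tendsto_nhdsWithin_iff.2 ⟨Tendsto.mono_left ?_ nhdsWithin_le_nhds, ?_⟩
  · exact Continuous.tendsto' (by fun_prop) _ _ (by simp)
  · filter_upwards [self_mem_nhdsWithin] with t ht
    simpa using ht

namespace IsAnalyticCGF

variable {Ω : Type*} [MeasurableSpace Ω] {X : Ω → ℝ} {P : Measure Ω} {H : ℝ} {L : ℂ → ℂ}

theorem of_charFun (hX : AEMeasurable X P)
    (hint : ∀ t : ℝ, |t| < H → Integrable (fun ω => Real.exp (t * X ω)) P)
    (hL : AnalyticOnNhd ℂ L (Metric.ball 0 H)) (hL0 : L 0 = 0)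
    (hchar : ∀ t : ℝ, |t| < H → charFun (P.map X) t = Complex.exp (L (t * Complex.I))) :
    IsAnalyticCGF X P H L := by
  refine ⟨hint, hL, hL0, fun z hz => ?_⟩
  have hH : 0 < H := Metric.pos_of_mem_ball hz
  have hmgf : AnalyticOnNhd ℂ (complexMGF X P) (Metric.ball 0 H) :=
    analyticOnNhd_complexMGF.mono fun w hw => mem_interior_integrableExpSet_of_abs_lt hint
      ((Complex.abs_re_le_norm w).trans_lt (mem_ball_zero_iff.1 hw))
  refine AnalyticOnNhd.eqOn_of_preconnected_of_frequently_eq (z₀ := 0) (fun w hw => (hL w hw).cexp')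
    hmgf (convex_ball (0 : ℂ) H).isPreconnected (Metric.mem_ball_self hH) ?_ hz
  refine tendsto_ofReal_mul_I_nhdsNE_zero.frequently (Eventually.frequently ?_)
  filter_upwards [nhdsWithin_le_nhds (Ioo_mem_nhds (neg_lt_zero.2 hH) hH)] with t ht
  rw [complexMGF_mul_I hX, hchar t (abs_lt.2 ht)]

theorem charFun_eq_exp (hL : IsAnalyticCGF X P H L) {t : ℝ} (ht : |t| < H) :
    charFun (P.map X) t = Complex.exp (L (t * Complex.I)) := by
  rw [← complexMGF_mul_I (hL.aemeasurable ((abs_nonneg t).trans_lt ht)),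
    hL.exp_eq _ (by simpa using ht)]

theorem mgf_le_exp_norm (hL : IsAnalyticCGF X P H L) {t : ℝ} (ht : |t| < H) :
    mgf X P t ≤ Real.exp ‖L t‖ := by
  rw [← abs_of_nonneg (mgf_nonneg (X := X) (μ := P) (t := t)), ← Real.norm_eq_abs,
    ← Complex.norm_real, ← complexMGF_ofReal, ← hL.exp_eq _ (ofReal_mem_ball_zero ht)]
  exact Complex.norm_exp_le_exp_norm _

theorem of_tendstoInMeasure [IsProbabilityMeasure P] {κ : Type*} {u : Filter κ} [u.NeBot]
    [u.IsCountablyGenerated] {Y : κ → Ω → ℝ} {Λ : κ → ℂ → ℂ} {M : ℝ} (hH : 0 < H)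
    (hYX : TendstoInMeasure P Y u X) (hY : ∀ k, IsAnalyticCGF (Y k) P H (Λ k))
    (hM : ∀ k z, ‖z‖ < H → ‖Λ k z‖ ≤ M) (hL : AnalyticOnNhd ℂ L (Metric.ball 0 H))
    (hΛ : ∀ z, ‖z‖ < H → Tendsto (fun k => Λ k z) u (𝓝 (L z))) : IsAnalyticCGF X P H L := by
  have hYm := fun k => (hY k).aemeasurable hH
  have hzero : Tendsto (fun k => Λ k 0) u (𝓝 0) := by
    simp only [(hY _).map_zero, tendsto_const_nhds]
  refine of_charFun (hYX.aemeasurable hYm) (fun t ht => ?_) hL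
    (tendsto_nhds_unique (hΛ 0 (by simpa using hH)) hzero) fun t ht => ?_
  · refine integrable_exp_mul_of_tendstoInMeasure hYX hYm (fun k => (hY k).integrable_exp t ht)
      (C := Real.exp M) fun k => ((hY k).mgf_le_exp_norm ht).trans (Real.exp_le_exp.2 ?_)
    exact hM k _ (by simpa using ht)
  · refine tendsto_nhds_unique (tendsto_charFun_of_tendstoInMeasure hYX hYm t) ?_
    simp only [(hY _).charFun_eq_exp ht]
    exact (Complex.continuous_exp.tendsto _).comp (hΛ _ (by simpa using ht))

theorem finsetSum {ι : Type*} {X : ι → Ω → ℝ} {L : ι → ℂ → ℂ} (hH : 0 < H)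
    (hindep : iIndepFun X P) (hL : ∀ j, IsAnalyticCGF (X j) P H (L j)) (s : Finset ι) :
    IsAnalyticCGF (fun ω => ∑ j ∈ s, X j ω) P H fun z => ∑ j ∈ s, L j z := by
  have := hindep.isProbabilityMeasure
  have hX := fun j => (hL j).aemeasurable hH
  refine of_charFun (Finset.aemeasurable_fun_sum _ fun j _ => hX j) (fun t ht => ?_)
    (Finset.analyticOnNhd_fun_sum _ fun j _ => (hL j).analytic) (by simp [(hL _).map_zero])
    fun t ht => ?_
  · refine .of_integral_ne_zero ?_
    have hmgf := hindep.mgf_sum₀ hX s (t := t)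
    simp only [mgf, Finset.sum_apply] at hmgf
    rw [hmgf]
    exact Finset.prod_ne_zero_iff.2 fun j _ => (mgf_pos ((hL j).integrable_exp t ht)).ne'
  · rw [(hindep.restrict s).charFun_map_fun_finsetSum_eq_prod fun j _ => hX j, Finset.prod_apply,
      Complex.exp_sum]
    exact Finset.prod_congr rfl fun j _ => (hL j).charFun_eq_exp ht

theorem div_const (hL : IsAnalyticCGF X P H L) {b : ℝ} (hb : 0 < b) :
    IsAnalyticCGF (fun ω => X ω / b) P (H * b) fun z => L ((b : ℂ)⁻¹ * z) := by
  have hmap : ∀ z ∈ Metric.ball (0 : ℂ) (H * b), (b : ℂ)⁻¹ * z ∈ Metric.ball (0 : ℂ) H := by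
    intro z hz
    rw [mem_ball_zero_iff] at hz ⊢
    rwa [norm_mul, norm_inv, Complex.norm_real, Real.norm_of_nonneg hb.le, inv_mul_lt_iff₀ hb,
      mul_comm b]
  refine ⟨fun t ht => ?_, ?_, by simp [hL.map_zero], fun z hz => ?_⟩
  · have hint := hL.integrable_exp (t / b) (by rwa [abs_div, abs_of_pos hb, div_lt_iff₀ hb])
    simpa only [div_mul_eq_mul_div, mul_div_assoc] using hint
  · exact fun z hz => (hL.analytic _ (hmap z hz)).fun_comp (by fun_prop)
  · rw [hL.exp_eq _ (hmap z hz), complexMGF, complexMGF]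
    push_cast
    simp only [← div_eq_inv_mul, div_mul_eq_mul_div, mul_div_assoc]

theorem cumulant_one [IsProbabilityMeasure P] (hL : IsAnalyticCGF X P H L) (hH : 0 < H) :
    cumulant 1 X P = ∫ ω, X ω ∂P := by
  rw [cumulant, iteratedDeriv_one,
    deriv_cgf_zero (hL.mem_interior_integrableExpSet (by simpa using hH)), probReal_univ, div_one]

theorem cumulant_two [IsProbabilityMeasure P] (hL : IsAnalyticCGF X P H L) (hH : 0 < H) :
    cumulant 2 X P = variance X P := by
  rw [cumulant, ← variance_tilted_mul (hL.mem_interior_integrableExpSet (by simpa using hH))]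
  simp

end IsAnalyticCGF

theorem iteratedDeriv_comp_mul_left {𝕜 F : Type*} [NontriviallyNormedField 𝕜]
    [NormedAddCommGroup F] [NormedSpace 𝕜 F] (a : 𝕜) (f : 𝕜 → F) (k : ℕ) :
    iteratedDeriv k (fun x => f (a * x)) = fun x => a ^ k • iteratedDeriv k f (a * x) := by
  induction k with
  | zero => simp
  | succ k ih =>
    ext x
    rw [iteratedDeriv_succ, ih, deriv_fun_const_smul_field, iteratedDeriv_succ,
      deriv_comp_mul_left, smul_smul, pow_succ]

theorem cumulant_div_const {Ω : Type*} [MeasurableSpace Ω] (X : Ω → ℝ) (P : Measure Ω) (k : ℕ)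
    (b : ℝ) : cumulant k (fun ω => X ω / b) P = cumulant k X P / b ^ k := by
  have hcgf : cgf (fun ω => X ω / b) P = fun t => cgf X P (b⁻¹ * t) := by
    ext t
    simp only [cgf, mgf, ← div_eq_inv_mul, div_mul_eq_mul_div, mul_div_assoc]
  rw [cumulant, hcgf, iteratedDeriv_comp_mul_left]
  simp only [cumulant, mul_zero, smul_eq_mul, inv_pow, div_eq_inv_mul]

theorem one_sub_normalizedDF {Ω : Type*} [MeasurableSpace Ω] {P : Measure Ω}
    [IsProbabilityMeasure P] {S : Ω → ℝ} (hS : AEMeasurable S P) {B : ℝ} (hB : 0 < B) (x : ℝ) :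
    1 - normalizedDF S B P x = P.real {ω | x ≤ S ω / √B} := by
  rw [normalizedDF, ← probReal_compl_eq_one_sub₀ (nullMeasurableSet_lt hS aemeasurable_const)]
  simp only [Set.compl_ofPred, not_lt, le_div_iff₀ (Real.sqrt_pos.2 hB)]

/-- `S` is the sum, possibly infinite, of the independent variables `X j`, whose cumulant generating
functions `L j` are analytic in the disc of radius `H` and bounded there by the terms of the
convergent series `∑ j, c j`. Convergence is only asked in probability and along one exhaustion of
the index set by finite sets. -/
structure IsIndepAnalyticSum {Ω ι : Type*} [MeasurableSpace Ω] (X : ι → Ω → ℝ) (P : Measure Ω)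
    (S : Ω → ℝ) (H : ℝ) (L : ι → ℂ → ℂ) (c : ι → ℝ) : Prop where
  indep : iIndepFun X P
  radius_pos : 0 < H
  isAnalyticCGF_summand : ∀ j, IsAnalyticCGF (X j) P H (L j)
  norm_le : ∀ j z, ‖z‖ < H → ‖L j z‖ ≤ c j
  summable : Summable c
  exists_tendsto : ∃ s : ℕ → Finset ι, Tendsto s atTop atTop ∧
    TendstoInMeasure P (fun m ω => ∑ j ∈ s m, X j ω) atTop S

namespace IsIndepAnalyticSum

variable {Ω ι : Type*} [MeasurableSpace Ω] {X : ι → Ω → ℝ} {P : Measure Ω} {S : Ω → ℝ} {H : ℝ}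
  {L : ι → ℂ → ℂ} {c : ι → ℝ}

theorem isProbabilityMeasure (hS : IsIndepAnalyticSum X P S H L c) : IsProbabilityMeasure P :=
  hS.indep.isProbabilityMeasure

theorem isAnalyticCGF (hS : IsIndepAnalyticSum X P S H L c) :
    IsAnalyticCGF S P H fun z => ∑' j, L j z := by
  have := hS.isProbabilityMeasure
  obtain ⟨s, hs, hXS⟩ := hS.exists_tendsto
  have hc : ∀ j, 0 ≤ c j := fun j =>
    (norm_nonneg _).trans (hS.norm_le j 0 (by simpa using hS.radius_pos))
  refine .of_tendstoInMeasure (M := ∑' j, c j) hS.radius_pos hXS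
    (fun m => .finsetSum hS.radius_pos hS.indep hS.isAnalyticCGF_summand (s m)) ?_ ?_ ?_
  · exact fun m z hz => (norm_sum_le_of_le _ fun j _ => hS.norm_le j z hz).trans
      (hS.summable.sum_le_tsum _ fun j _ => hc j)
  · exact (Complex.differentiableOn_tsum_of_summable_norm hS.summable
      (fun j => (hS.isAnalyticCGF_summand j).analytic.differentiableOn) Metric.isOpen_ball
      fun j z hz => hS.norm_le j z (mem_ball_zero_iff.1 hz)).analyticOnNhd Metric.isOpen_ball
  · exact fun z hz =>
      (Summable.of_norm_bounded hS.summable fun j => hS.norm_le j z hz).hasSum.comp hs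

theorem hasSum_cumulant (hS : IsIndepAnalyticSum X P S H L c) (k : ℕ) :
    HasSum (fun j => cumulant k (X j) P) (cumulant k S P) := by
  have := hS.isProbabilityMeasure
  have hsum := hasSum_iteratedDeriv_tsum k hS.radius_pos hS.summable
    (fun j => (hS.isAnalyticCGF_summand j).analytic) hS.norm_le
  simp only [(hS.isAnalyticCGF_summand _).iteratedDeriv_zero_eq_cumulant hS.radius_pos,
    hS.isAnalyticCGF.iteratedDeriv_zero_eq_cumulant hS.radius_pos] at hsum
  exact Complex.hasSum_ofReal.1 hsum

theorem isStandardizedCGF (hS : IsIndepAnalyticSum X P S H L c)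
    (hmean : ∀ j, ∫ ω, X j ω ∂P = 0) {B : ℝ} (hB : HasSum (fun j => variance (X j) P) B)
    (hBpos : 0 < B) {A : ℝ} (hA : ∑' j, c j ≤ A * (B * H ^ 2)) :
    IsStandardizedCGF (fun ω => S ω / √B) P (H * √B) A fun z => ∑' j, L j ((√B : ℂ)⁻¹ * z) := by
  have := hS.isProbabilityMeasure
  have hb : 0 < √B := Real.sqrt_pos.2 hBpos
  have hone : cumulant 1 S P = 0 := by
    refine (hS.hasSum_cumulant 1).unique ?_
    simp only [(hS.isAnalyticCGF_summand _).cumulant_one hS.radius_pos, hmean, hasSum_zero]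
  have htwo : cumulant 2 S P = B := by
    refine (hS.hasSum_cumulant 2).unique ?_
    simpa only [(hS.isAnalyticCGF_summand _).cumulant_two hS.radius_pos] using hB
  refine ⟨hS.isAnalyticCGF.div_const hb, mul_pos hS.radius_pos hb, fun z hz => ?_, ?_, ?_⟩
  · have hzb : ‖(√B : ℂ)⁻¹ * z‖ < H := by
      rwa [norm_mul, norm_inv, Complex.norm_real, Real.norm_of_nonneg hb.le, inv_mul_lt_iff₀ hb,
        mul_comm]
    calc ‖∑' j, L j ((√B : ℂ)⁻¹ * z)‖ ≤ ∑' j, c j :=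
          tsum_of_norm_bounded hS.summable.hasSum fun j => hS.norm_le j _ hzb
      _ ≤ A * (B * H ^ 2) := hA
      _ = A * (H * √B) ^ 2 := by rw [mul_pow, Real.sq_sqrt hBpos.le, mul_comm B]
  · rw [cumulant_div_const, hone, zero_div]
  · rw [cumulant_div_const, htwo, Real.sq_sqrt hBpos.le, div_self hBpos.ne']

theorem cumulant_three_div_sqrt (hS : IsIndepAnalyticSum X P S H L c) {B : ℝ} (hB : 0 ≤ B) :
    cumulant 3 (fun ω => S ω / √B) P = (∑' j, cumulant 3 (X j) P) / B ^ (3 / 2 : ℝ) := by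
  have hpow : B ^ (3 / 2 : ℝ) = √B ^ 3 := by
    rw [Real.sqrt_eq_rpow, ← Real.rpow_mul_natCast hB]
    norm_num
  rw [cumulant_div_const, hpow, (hS.hasSum_cumulant 3).tsum_eq]

end IsIndepAnalyticSum

theorem pow_three_le_of_le_mul_rpow {x y K : ℝ} (hx : 0 ≤ x) (hy : 0 ≤ y)
    (hxy : x ≤ K * y ^ (1 / 3 : ℝ)) : x ^ 3 ≤ K ^ 3 * y := by
  refine (pow_le_pow_left₀ hx hxy 3).trans_eq ?_
  rw [mul_pow, ← Real.rpow_mul_natCast hy]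
  norm_num

theorem mainTheorem4_general {N : Type*} {l : Filter N} {Ω ι : N → Type*}
    [∀ n, MeasurableSpace (Ω n)] {P : ∀ n, Measure (Ω n)} {X : ∀ n, ι n → Ω n → ℝ}
    {S : ∀ n, Ω n → ℝ} {H : N → ℝ} {L : ∀ n, ι n → ℂ → ℂ} {c : ∀ n, ι n → ℝ} {B : N → ℝ}
    (hS : ∀ n, IsIndepAnalyticSum (X n) (P n) (S n) (H n) (L n) (c n))
    (hmean : ∀ n j, ∫ ω, X n j ω ∂(P n) = 0)
    (hB : ∀ n, HasSum (fun j => variance (X n j) (P n)) (B n))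
    (hBH : Tendsto (fun n => B n * H n ^ 2) l atTop)
    (hC : (fun n => ∑' j, c n j) =O[l] fun n => B n * H n ^ 2) :
    (∀ n, Summable fun j => cumulant 3 (X n j) (P n)) ∧
    ∀ K : ℝ, ∃ M : ℝ, ∀ᶠ n in l, ∀ x : ℝ, 0 ≤ x → x ≤ K * (H n * √(B n)) ^ (1 / 3 : ℝ) →
      |(1 - normalizedDF (S n) (B n) (P n) x) - (1 - stdNormalDF x) *
          Real.exp (x ^ 3 / (6 * B n ^ (3 / 2 : ℝ)) * ∑' j, cumulant 3 (X n j) (P n))| ≤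
        M * (Real.exp (-x ^ 2 / 2) / (H n * √(B n))) := by
  refine ⟨fun n => ((hS n).hasSum_cumulant 3).summable, fun K => ?_⟩
  obtain ⟨A, hA⟩ := hC.bound
  obtain ⟨M, D₀, hM⟩ := exists_abs_measureReal_ge_sub_le A (K ^ 3)
  refine ⟨M, ?_⟩
  filter_upwards [hA, hBH.eventually_gt_atTop 0, hBH.eventually_ge_atTop (D₀ ^ 2)]
    with n hAn hpos hD₀ x hx hxK
  have := (hS n).isProbabilityMeasure
  have hBpos : 0 < B n := pos_of_mul_pos_left hpos (sq_nonneg _)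
  have hZ := (hS n).isStandardizedCGF (hmean n) (hB n) hBpos (A := A) <| by
    rw [Real.norm_of_nonneg hpos.le] at hAn
    exact (Real.le_norm_self _).trans hAn
  have hD : D₀ ≤ H n * √(B n) := by
    refine (abs_le_of_sq_le_sq' ?_ hZ.radius_pos.le).2
    rwa [mul_pow, Real.sq_sqrt hBpos.le, mul_comm]
  have hlarge := hM hZ hD hx (pow_three_le_of_le_mul_rpow hx hZ.radius_pos.le hxK)
  rw [(hS n).cumulant_three_div_sqrt hBpos.le] at hlarge
  rw [one_sub_normalizedDF ((hS n).isAnalyticCGF.aemeasurable (hS n).radius_pos) hBpos]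
  convert hlarge using 5
  ring

theorem tendsto_latticeCube (d : ℕ) : Tendsto (latticeCube d) atTop atTop := by
  refine tendsto_atTop_finset_of_monotone (fun m n hmn => ?_) fun j => ?_
  · have hcast : (m : ℤ) ≤ n := by exact_mod_cast hmn
    exact Finset.Icc_subset_Icc (fun _ => neg_le_neg hcast) fun _ => hcast
  · refine ⟨∑ i, (j i).natAbs, Finset.mem_Icc.2 (forall_and.1 fun i => ?_)⟩
    have hle : (j i).natAbs ≤ ∑ i, (j i).natAbs :=
      Finset.single_le_sum_of_canonicallyOrdered (f := fun i => (j i).natAbs)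
        (Finset.mem_univ i)
    simp only
    omega

theorem mainTheorem4 {Ω : Type*} [MeasurableSpace Ω] (P : Measure Ω) [IsProbabilityMeasure P]
    (d : ℕ) (X : ℕ → (Fin d → ℤ) → Ω → ℝ) (S : ℕ → Ω → ℝ)
    (H : ℕ → ℝ) (L : ℕ → (Fin d → ℤ) → ℂ → ℂ) (c : ℕ → (Fin d → ℤ) → ℝ)
    (hX : ∀ n j, AEMeasurable (X n j) P)
    (hmean : ∀ n j, ∫ ω, X n j ω ∂P = 0)
    (hindep : ∀ n, iIndepFun (X n) P)
    (hH : ∀ n, 0 < H n)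
    (hL : ∀ n j, IsAnalyticCGF (X n j) P (H n) (L n j))
    (hS : ∀ n, IsLatticeSum (X n) P (S n))
    (hB : ∀ n, Summable (fun j => variance (X n j) P))
    (hc : ∀ n j, 0 ≤ c n j)
    (hLc : ∀ n j, ∀ z : ℂ, ‖z‖ < H n → ‖L n j z‖ ≤ c n j)
    (hBH : Tendsto (fun n => latticeVariance (X n) P * H n ^ 2) atTop atTop)
    (hcsum : ∀ n, Summable (c n))
    (hC : (fun n => ∑' j, c n j) =O[atTop] (fun n => latticeVariance (X n) P * H n ^ 2)) :
    (∀ n, Summable (fun j => cumulant 3 (X n j) P)) ∧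
    ∀ K : ℝ, ∃ M : ℝ, ∀ᶠ n in atTop, ∀ x : ℝ, 0 ≤ x →
      x ≤ K * (H n * √(latticeVariance (X n) P)) ^ (1 / 3 : ℝ) →
      |(1 - normalizedDF (S n) (latticeVariance (X n) P) P x)
          - (1 - stdNormalDF x) *
            Real.exp (x ^ 3 / (6 * (latticeVariance (X n) P) ^ (3 / 2 : ℝ))
              * ∑' j, cumulant 3 (X n j) P)|
        ≤ M * (Real.exp (-x ^ 2 / 2) / (H n * √(latticeVariance (X n) P))) :=
  mainTheorem4_general (fun n => ⟨hindep n, hH n, hL n, hLc n, hcsum n,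
    latticeCube d, tendsto_latticeCube d, hS n⟩) hmean (fun n => (hB n).hasSum) hBH hC
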